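/- Let $\phi(t)=t$, $p=1$ (linear networks) or $\phi(t)=\max\{t,0\}$, $p=\tfrac12$ (ReLU networks). For depth $L$, width $d$, data $x_i\in\mathbb R^{d_{in}}$, $y_i\in\mathbb R^{d_{out}}$ $(i=1,\dots,n)$ and matrices $A\in\mathbb R^{d\times d_{in}}$, $B\in\mathbb R^{d_{out}\times d}$, consider the loss of the hidden weights $W=(W^1,\dots,W^L)$, $W^\ell\in\mathbb R^{d\times d}$, $$\mathcal L(W)=\frac1{2n}\sum_{i=1}^n\bigl\|y_i-B D_i^L W^L D_i^{L-1}W^{L-1}\cdots W^1D_i^0A x_i\bigr\|_2^2 ,$$ where $D_i^\ell$ is the diagonal matrix of activation gates at layer $\ell$ for the input $x_i$: the identity for linear networks; for ReLU networks the entry is $1$ if the preactivation is positive and $0$ otherwise. All entries of $W^1,\dots,W^L$ are i.i.d. with a law $\mathcal P$ that is symmetric around $0$ and has variance $\sigma^2$ and finite fourth moment. $A$ and $B$ are fixed, or more generally random and independent of $W$. Let $H$ be the $Ld^2\times Ld^2$ Hessian of $\mathcal L$ with respect to $W$ at this initialization, the gates being treated as constants under differentiation, and let $|\lambda_{\max}|$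 be the largest absolute value of an eigenvalue of $H$. Assume $\|y_i\|_2\le K$ and $\mathbb E[\|B\|_F^2\|Ax_i\|_2^2]\le K^2$ for all $i$, and $pd\sigma^2\ge s_0>0$. (1) If $pd\sigma^2\le1$ (vanishing or stable regime), then $$\mathbb E\,|\lambda_{\max}|\le L\,d\cdot C\,(pd\sigma^2)^{L/2}$$ with a constant $C$ that depends only on $K$ and $s_0$ (for each of the two kinds of network), not on $L$, $d$, $n$, $d_{in}$, $d_{out}$ or $\mathcal P$. That is, $\mathbb E|\lambda^{\rm linear}_{\max}|\le Ld\cdot\mathcal O((d\sigma^2)^{L/2})$ and $\mathbb E|\lambda^{\rm ReLU}_{\max}|\le Ld\cdot\mathcal O((\tfrac d2\sigma^2)^{L/2})$. (2) If, instead, only $pd\sigma^2\le s_1$ for some $s_1$, the same bound holds with a constant $C$ that depends only on $K,s_0,s_1$ and $L$. (3) For linear networks, and for ReLU networks when $\mathcal P$ has no atoms, the loss is almost surely twice differentiable at the initialization in the sense of being $C^2$ near it (no lower or upper bound on $pd\sigma^2$ and no bound $K$ is needed here), and its Hessian there is $H$. -/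

import Mathlib

open MeasureTheory ProbabilityTheory
open scoped Matrix ENNReal Topology

universe u

noncomputable section

/-- The two nonlinearities: `φ(t) = t` (linear networks) and `φ(t) = max t 0` (ReLU networks). -/
inductive Activation where
  | linear : Activation
  | relu : Activation

namespace Activation

/-- The nonlinearity itself. -/
def fn : Activation → ℝ → ℝ
  | linear, t => t
  | relu, t => max t 0

/-- The activation gate, `1` or `0`, that a preactivation `t` produces. -/
def gate : Activation → ℝ → ℝ
  | linear, _ => 1
  | relu, t => if 0 < t then 1 else 0

/-- The parameter `p`: `1` for linear networks, `1/2` for ReLU networks. -/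
def p : Activation → ℝ
  | linear => 1
  | relu => 1 / 2

/-- Multiplying by the gate is the same as applying the nonlinearity. -/
theorem gate_mul_self (act : Activation) (t : ℝ) : act.gate t * t = act.fn t := by
  cases act with
  | linear => simp [gate, fn]
  | relu =>
    by_cases h : 0 < t
    · simp [gate, fn, h, h.le]
    · simp [gate, fn, h, not_lt.mp h]

end Activation

/-- Index set of the weights: `(ℓ, i, j)` stands for the entry `(i, j)` of the weight matrix of
the hidden layer number `ℓ + 1`. -/
abbrev WeightIndex (L d : ℕ) : Type := Fin L × Fin d × Fin d

/-- The weight matrix with number `k + 1` (only used for `k < L`). -/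
def weightMatrix {L d : ℕ} (w : WeightIndex L d → ℝ) (k : ℕ) : Matrix (Fin d) (Fin d) ℝ :=
  Matrix.of fun i j => if h : k < L then w (⟨k, h⟩, i, j) else 0

/-- Preactivations for the network input `z = A x`: `g⁰ = z`, `gᵏ⁺¹ = Wᵏ⁺¹ φ(gᵏ)`. -/
def preact (act : Activation) {L d : ℕ} (w : WeightIndex L d → ℝ) (z : Fin d → ℝ) :
    ℕ → Fin d → ℝ
  | 0 => z
  | k + 1 => weightMatrix w k *ᵥ fun j => act.fn (preact act w z k j)

/-- Forward pass with prescribed gates `D`: `z ↦ Wᵏ Dᵏ⁻¹ Wᵏ⁻¹ ⋯ W¹ D⁰ z`. -/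
def gatedForward {L d : ℕ} (D : ℕ → Fin d → ℝ) (w : WeightIndex L d → ℝ) (z : Fin d → ℝ) :
    ℕ → Fin d → ℝ
  | 0 => z
  | k + 1 => weightMatrix w k *ᵥ fun j => D k j * gatedForward D w z k j

/-- The square loss `1/(2n) ∑ᵢ ‖yᵢ - B φ(g^L(A xᵢ))‖²` as a function of the hidden weights. -/
def mlpLoss (act : Activation) {L d din dout n : ℕ}
    (A : Matrix (Fin d) (Fin din) ℝ) (B : Matrix (Fin dout) (Fin d) ℝ)
    (x : Fin n → Fin din → ℝ) (y : Fin n → Fin dout → ℝ) (w : WeightIndex L d → ℝ) : ℝ :=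
  1 / (2 * (n : ℝ)) * ∑ i, ∑ o,
    (y i o - (B *ᵥ fun j => act.fn (preact act w (A *ᵥ x i) L j)) o) ^ 2

/-- The square loss `1/(2n) ∑ᵢ ‖yᵢ - B D^L W^L D^{L-1} ⋯ W¹ D⁰ A xᵢ‖²` at the weights `w`, where
for every sample the gates `D⁰, …, D^L` are those produced by the weights `w₀`. -/
def gatedLoss (act : Activation) {L d din dout n : ℕ}
    (A : Matrix (Fin d) (Fin din) ℝ) (B : Matrix (Fin dout) (Fin d) ℝ)
    (x : Fin n → Fin din → ℝ) (y : Fin n → Fin dout → ℝ) (w₀ w : WeightIndex L d → ℝ) : ℝ :=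
  1 / (2 * (n : ℝ)) * ∑ i, ∑ o,
    (y i o - (B *ᵥ fun j => act.gate (preact act w₀ (A *ᵥ x i) L j) *
      gatedForward (fun k m => act.gate (preact act w₀ (A *ᵥ x i) k m)) w (A *ᵥ x i) L j) o) ^ 2

/-- The Hessian matrix of `f` at `w`. -/
def hessianMatrix {ι : Type*} [Fintype ι] [DecidableEq ι] (f : (ι → ℝ) → ℝ) (w : ι → ℝ) :
    Matrix ι ι ℝ :=
  Matrix.of fun a b => iteratedFDeriv ℝ 2 f w ![Pi.single a 1, Pi.single b 1]

/-- The Hessian of the network loss at `w`, with the activation gates at `w` treated as constant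
matrices under differentiation. This is defined for all `w`; it is the Hessian of `mlpLoss` for
linear networks, and for ReLU networks wherever the gates are locally constant. -/
def networkHessian (act : Activation) {L d din dout n : ℕ}
    (A : Matrix (Fin d) (Fin din) ℝ) (B : Matrix (Fin dout) (Fin d) ℝ)
    (x : Fin n → Fin din → ℝ) (y : Fin n → Fin dout → ℝ) (w : WeightIndex L d → ℝ) :
    Matrix (WeightIndex L d) (WeightIndex L d) ℝ :=
  hessianMatrix (gatedLoss act A B x y w) w

/-- `P` is a probability law on `ℝ`, symmetric around zero, with standard deviation `σ` and finite
fourth moment. -/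
structure IsInitLaw (P : Measure ℝ) (σ : ℝ) : Prop where
  isProbabilityMeasure : IsProbabilityMeasure P
  symmetric : P.map (fun t => -t) = P
  fourth_moment : MemLp id 4 P
  sigma_nonneg : 0 ≤ σ
  variance_eq : variance id P = σ ^ 2

/-- A randomly initialized network of depth `L` and width `d` together with its data set: the
entries of the hidden weight matrices are i.i.d. with law `P`. The input and output matrices are
independent of them and otherwise arbitrary (for instance constant). -/
structure RandomNetwork (L d : ℕ) (P : Measure ℝ) where
  /-- the sample space -/
  Ω : Type u
  [measurableSpace : MeasurableSpace Ω]
  /-- the underlying probability -/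
  μ : Measure Ω
  [isProbabilityMeasure : IsProbabilityMeasure μ]
  /-- input dimension -/
  din : ℕ
  /-- output dimension -/
  dout : ℕ
  /-- number of data points -/
  n : ℕ
  /-- inputs -/
  x : Fin n → Fin din → ℝ
  /-- targets -/
  y : Fin n → Fin dout → ℝ
  /-- input matrix -/
  A : Ω → Matrix (Fin d) (Fin din) ℝ
  /-- output matrix -/
  B : Ω → Matrix (Fin dout) (Fin d) ℝ
  /-- hidden weights -/
  W : Ω → WeightIndex L d → ℝ
  measurable_A : ∀ i j, Measurable fun ω => A ω i j
  measurable_B : ∀ i j, Measurable fun ω => B ω i j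
  measurable_W : ∀ a, Measurable fun ω => W ω a
  law_W : ∀ a, μ.map (fun ω => W ω a) = P
  indep_W : iIndepFun (fun a ω => W ω a) μ
  indep_AB_W : IndepFun (fun ω => ((fun i j => A ω i j, fun i j => B ω i j) :
    (Fin d → Fin din → ℝ) × (Fin dout → Fin d → ℝ))) W μ

attribute [instance] RandomNetwork.measurableSpace RandomNetwork.isProbabilityMeasure

namespace RandomNetwork

variable {L d : ℕ} {P : Measure ℝ}

/-- The loss as a function of the hidden weights, at the outcome `ω` of the input and output
matrices. -/
def loss (N : RandomNetwork L d P) (act : Activation) (ω : N.Ω) (w : WeightIndex L d → ℝ) : ℝ :=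
  mlpLoss act (N.A ω) (N.B ω) N.x N.y w

/-- The Hessian of the loss at the random initialization. -/
def hessian (N : RandomNetwork L d P) (act : Activation) (ω : N.Ω) :
    Matrix (WeightIndex L d) (WeightIndex L d) ℝ :=
  networkHessian act (N.A ω) (N.B ω) N.x N.y (N.W ω)

/-- Expectation of the largest absolute value of an eigenvalue of the Hessian at initialization. -/
def expectedMaxEigenvalue (N : RandomNetwork L d P) (act : Activation) : ℝ≥0∞ :=
  ∫⁻ ω, spectralRadius ℝ (N.hessian act ω) ∂N.μ

/-- The data and the outer layers are bounded by `K`: `‖yᵢ‖ ≤ K` and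
`E[‖B‖_F² ‖A xᵢ‖²] ≤ K²`; for constant `A`, `B` the latter is `‖B‖_F ‖A xᵢ‖ ≤ K`. -/
structure BoundedBy (N : RandomNetwork L d P) (K : ℝ) : Prop where
  nonneg : 0 ≤ K
  target : ∀ i, ∑ o, N.y i o ^ 2 ≤ K ^ 2
  outer : ∀ i, ∫⁻ ω, ENNReal.ofReal ((∑ o, ∑ j, N.B ω o j ^ 2) * ∑ j, (N.A ω *ᵥ N.x i) j ^ 2) ∂N.μ
    ≤ ENNReal.ofReal (K ^ 2)

end RandomNetwork

end

/-!
With the gates frozen, every output coordinate `f` is affine in each layer separately. Its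
derivative in direction of a weight is therefore the output of the same network with the layer of
that weight replaced by a matrix unit, and a second derivative is the output with two layers
replaced (or zero, within one layer). The Hessian of the loss is an average of terms
`∇f ∇fᵀ - (y - f) ∇²f`, and the Frobenius norm bounds its eigenvalues.

One random layer with its gates multiplies the mean square of the activations by at most
`s = p d σ²`, where the `1/2` for ReLU comes from the sign symmetry: of the weights `w` and `-w` of
a neuron at most one opens the gate. The gates depend on the true weights and not on the replaced
ones, but earlier layers stay independent of later ones, so the estimate applies to the networks
with replaced layers as well, each replacement trading a factor `s` for `d` after summing over the
matrix units. Hence the mean squares of `f`, `∇f` and `∇²f` are of order `sᴸ`, `L d sᴸ⁻¹` and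
`L² d² sᴸ⁻²`, and `|(y - f) ∇²f| ≤ c (y² + f²) + c⁻¹ |∇²f|²` with `c = L d s^(L/2)` gives the bound.

For ReLU networks with an atomless law, almost surely each preactivation is nonzero unless all
inputs of its neuron vanish, since it is affine in each weight. The gates, up to those of neurons
that stay dead, are then locally constant, and the loss coincides locally with the gated loss.
-/

/-- The squared Euclidean norm, valued in `ℝ≥0∞` so that it can be integrated without side
conditions. -/
noncomputable def sqNorm {ι : Type*} [Fintype ι] (v : ι → ℝ) : ℝ≥0∞ := ∑ j, ‖v j‖ₑ ^ 2

section SqNorm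

variable {m n : Type*} [Fintype m] [Fintype n]

theorem sqNorm_eq_ofReal (v : n → ℝ) : sqNorm v = ENNReal.ofReal (∑ j, v j ^ 2) := by
  rw [ENNReal.ofReal_sum_of_nonneg fun j _ => sq_nonneg (v j)]
  exact Finset.sum_congr rfl fun j _ => by
    rw [Real.enorm_eq_ofReal_abs, ← ENNReal.ofReal_pow (abs_nonneg _), sq_abs]

theorem sum_sqNorm_eq_ofReal (B : Matrix m n ℝ) :
    ∑ o, sqNorm (B o) = ENNReal.ofReal (∑ o, ∑ j, B o j ^ 2) := by
  simp only [sqNorm_eq_ofReal]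
  exact (ENNReal.ofReal_sum_of_nonneg fun o _ => Finset.sum_nonneg fun j _ => sq_nonneg _).symm

theorem sqNorm_mulVec_le (B : Matrix m n ℝ) (v : n → ℝ) :
    sqNorm (B *ᵥ v) ≤ (∑ o, sqNorm (B o)) * sqNorm v := by
  rw [sum_sqNorm_eq_ofReal, sqNorm_eq_ofReal, sqNorm_eq_ofReal,
    ← ENNReal.ofReal_mul (by positivity), Finset.sum_mul]
  exact ENNReal.ofReal_le_ofReal
    (Finset.sum_le_sum fun o _ => Finset.sum_mul_sq_le_sq_mul_sq _ (B o) v)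

theorem continuous_sqNorm : Continuous (sqNorm : (n → ℝ) → ℝ≥0∞) := by
  simp only [funext sqNorm_eq_ofReal]
  exact ENNReal.continuous_ofReal.comp (by fun_prop)

end SqNorm

theorem mul_le_mul_sq_add_inv_mul_sq {c : ℝ≥0∞} (h0 : c ≠ 0) (htop : c ≠ ⊤)
    (x y : ℝ≥0∞) : x * y ≤ c * x ^ 2 + c⁻¹ * y ^ 2 := by
  rcases le_total y (c * x) with h | h
  · calc x * y ≤ x * (c * x) := by gcongr
      _ = c * x ^ 2 := by ring
      _ ≤ _ := le_self_add
  · have hx : x ≤ c⁻¹ * y := by rwa [← ENNReal.div_eq_inv_mul, ENNReal.le_div_iff_mul_le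
      (.inl h0) (.inl htop), mul_comm]
    calc x * y ≤ c⁻¹ * y * y := by gcongr
      _ = c⁻¹ * y ^ 2 := by ring
      _ ≤ _ := le_add_self

section SpectralRadius

variable {ι κ : Type*} [Fintype ι] [Fintype κ]

attribute [local instance] Matrix.frobeniusNormedAddCommGroup Matrix.frobeniusNormedSpace

theorem frobenius_enorm_sq (M : Matrix ι ι ℝ) : ‖M‖ₑ ^ 2 = ∑ a, sqNorm (M a) := by
  rw [sum_sqNorm_eq_ofReal, ← ofReal_norm, ← ENNReal.ofReal_pow (norm_nonneg _),
    Matrix.frobenius_norm_def, ← Real.sqrt_eq_rpow, Real.sq_sqrt (by positivity)]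
  simp

theorem frobenius_enorm_vecMulVec_self (v : ι → ℝ) : ‖Matrix.vecMulVec v v‖ₑ = sqNorm v := by
  refine (ENNReal.pow_right_strictMono two_ne_zero).injective ?_
  simp only [frobenius_enorm_sq, sqNorm, Matrix.vecMulVec_apply, enorm_mul, mul_pow,
    ← Finset.mul_sum, ← Finset.sum_mul]
  rw [sq]

variable [DecidableEq ι]

theorem exists_mulVec_eq_smul_of_mem_spectrum {M : Matrix ι ι ℝ} {t : ℝ}
    (ht : t ∈ spectrum ℝ M) : ∃ v ≠ 0, M *ᵥ v = t • v := by
  rw [← Matrix.spectrum_toLin', ← Module.End.hasEigenvalue_iff_mem_spectrum] at ht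
  obtain ⟨v, hv⟩ := ht.exists_hasEigenvector
  exact ⟨v, hv.2, hv.apply_eq_smul⟩

theorem spectralRadius_le_frobenius_enorm (M : Matrix ι ι ℝ) : spectralRadius ℝ M ≤ ‖M‖ₑ := by
  refine iSup₂_le fun t ht => ?_
  obtain ⟨v, hv0, hv⟩ := exists_mulVec_eq_smul_of_mem_spectrum ht
  let V : Matrix ι Unit ℝ := Matrix.replicateCol Unit v
  have hV : V ≠ 0 := fun h => hv0 (funext fun i => congrFun (congrFun h i) ())
  have hMV : M * V = t • V := by
    rw [← Matrix.replicateCol_mulVec, hv, Matrix.replicateCol_smul]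
  have hnorm : ‖t‖ * ‖V‖ ≤ ‖M‖ * ‖V‖ := by
    rw [← norm_smul, ← hMV]
    exact Matrix.frobenius_norm_mul M V
  exact enorm_le_iff_norm_le.mpr (le_of_mul_le_mul_right hnorm (norm_pos_iff.mpr hV))

theorem spectralRadius_smul_sum_vecMulVec_sub_le {c : ℝ≥0∞} (h0 : c ≠ 0) (htop : c ≠ ⊤) (r : ℝ)
    (J : κ → ι → ℝ) (y f : κ → ℝ) (h : κ → Matrix ι ι ℝ) :
    spectralRadius ℝ (r • ∑ q, (Matrix.vecMulVec (J q) (J q) - (y q - f q) • h q)) ≤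
      ‖r‖ₑ * ∑ q, (sqNorm (J q) + c * (‖y q‖ₑ ^ 2 + ‖f q‖ₑ ^ 2)
        + 2 * c⁻¹ * ∑ a, sqNorm (h q a)) := by
  refine (spectralRadius_le_frobenius_enorm _).trans ?_
  rw [enorm_smul]
  gcongr
  have triangle (M : κ → Matrix ι ι ℝ) : ‖∑ q, M q‖ₑ ≤ ∑ q, ‖M q‖ₑ := by
    simpa only [enorm_eq_nnnorm] using mod_cast nnnorm_sum_le Finset.univ M
  refine (triangle _).trans (Finset.sum_le_sum fun q _ => ?_)
  calc ‖Matrix.vecMulVec (J q) (J q) - (y q - f q) • h q‖ₑ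
    _ ≤ sqNorm (J q) + (‖y q‖ₑ + ‖f q‖ₑ) * ‖h q‖ₑ := by
      rw [← frobenius_enorm_vecMulVec_self]
      refine enorm_sub_le.trans ?_
      rw [enorm_smul]
      gcongr
      exact enorm_sub_le
    _ ≤ sqNorm (J q) + (c * ‖y q‖ₑ ^ 2 + c⁻¹ * ‖h q‖ₑ ^ 2
          + (c * ‖f q‖ₑ ^ 2 + c⁻¹ * ‖h q‖ₑ ^ 2)) := by
      rw [add_mul]
      gcongr <;> exact mul_le_mul_sq_add_inv_mul_sq h0 htop _ _
    _ = _ := by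
      rw [frobenius_enorm_sq]
      ring

end SpectralRadius

section Calculus

variable {E : Type*} [NormedAddCommGroup E] [NormedSpace ℝ E]
variable {ι κ : Type*} [Fintype ι] [Fintype κ]

theorem fderiv_apply_eq_of_forall_add_smul {f : E → ℝ} {w e : E} {c : ℝ}
    (hf : DifferentiableAt ℝ f w) (h : ∀ t : ℝ, f (w + t • e) = f w + t * c) :
    fderiv ℝ f w e = c := by
  rw [← hf.lineDeriv_eq_fderiv]
  refine HasDerivAt.deriv ?_
  simp only [h]
  simpa using ((hasDerivAt_id (0 : ℝ)).mul_const c).const_add (f w)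

theorem hasFDerivAt_const_mul_sum_sq_sub (c : ℝ) (y : κ → ℝ) {f : κ → E → ℝ} {w : E}
    (hf : ∀ q, DifferentiableAt ℝ (f q) w) :
    HasFDerivAt (fun w => c * ∑ q, (y q - f q w) ^ 2)
      (-(2 * c) • ∑ q, (y q - f q w) • fderiv ℝ (f q) w) w := by
  refine ((HasFDerivAt.fun_sum fun q _ =>
    ((hf q).hasFDerivAt.const_sub (y q)).pow 2).const_mul c).congr_fderiv ?_
  ext e
  simp only [Finset.smul_sum, sum_apply, smul_apply,
    neg_apply, smul_eq_mul]
  exact Finset.sum_congr rfl fun q _ => by push_cast; ring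

variable [DecidableEq ι]

theorem hessianMatrix_apply {f : (ι → ℝ) → ℝ} (hf : ContDiff ℝ 2 f) (w : ι → ℝ) (a b : ι) :
    hessianMatrix f w a b =
      fderiv ℝ (fun v => fderiv ℝ f v (Pi.single b 1)) w (Pi.single a 1) := by
  have hdf : DifferentiableAt ℝ (fderiv ℝ f) w :=
    (hf.fderiv_right (m := 1) (by norm_num)).differentiable one_ne_zero w
  rw [hessianMatrix, Matrix.of_apply, iteratedFDeriv_two_apply, fderiv_clm_apply hdf (by fun_prop)]
  simp

theorem hessianMatrix_const_mul_sum_sq_sub (c : ℝ) (y : κ → ℝ) {f : κ → (ι → ℝ) → ℝ}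
    (hf : ∀ q, ContDiff ℝ 2 (f q)) (w : ι → ℝ) :
    hessianMatrix (fun w => c * ∑ q, (y q - f q w) ^ 2) w =
      (2 * c) • ∑ q, (Matrix.vecMulVec (fun a => fderiv ℝ (f q) w (Pi.single a 1))
        (fun a => fderiv ℝ (f q) w (Pi.single a 1)) - (y q - f q w) • hessianMatrix (f q) w) := by
  have hf1 (q : κ) : Differentiable ℝ (f q) := (hf q).differentiable two_ne_zero
  have hf2 (q : κ) : Differentiable ℝ (fderiv ℝ (f q)) :=
    ((hf q).fderiv_right (m := 1) (by norm_num)).differentiable one_ne_zero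
  have gradient (b : ι) (v : ι → ℝ) :
      fderiv ℝ (fun w => c * ∑ q, (y q - f q w) ^ 2) v (Pi.single b 1) =
        -(2 * c) * ∑ q, (y q - f q v) * fderiv ℝ (f q) v (Pi.single b 1) := by
    rw [(hasFDerivAt_const_mul_sum_sq_sub c y fun q => hf1 q v).fderiv]
    simp
  ext a b
  rw [hessianMatrix_apply (by fun_prop)]
  simp only [gradient]
  have product (q : κ) : HasFDerivAt (fun v => (y q - f q v) * fderiv ℝ (f q) v (Pi.single b 1))
      ((y q - f q w) • fderiv ℝ (fun v => fderiv ℝ (f q) v (Pi.single b 1)) w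
        + fderiv ℝ (f q) w (Pi.single b 1) • -fderiv ℝ (f q) w) w :=
    ((hf1 q w).hasFDerivAt.const_sub (y q)).mul
      (((hf2 q).clm_apply (by fun_prop) : Differentiable ℝ fun v =>
        fderiv ℝ (f q) v (Pi.single b 1)) w).hasFDerivAt
  rw [((HasFDerivAt.fun_sum fun q (_ : q ∈ Finset.univ) => product q).const_mul _).fderiv]
  simp only [smul_apply, sum_apply,
    add_apply, neg_apply, smul_eq_mul,
    ← hessianMatrix_apply (hf _), Matrix.smul_apply, Matrix.sum_apply, Matrix.sub_apply,
    Matrix.vecMulVec_apply, Finset.mul_sum]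
  exact Finset.sum_congr rfl fun q _ => by ring

end Calculus

section UnitLayer

variable {L d : ℕ}

theorem gatedForward_congr {D D' : ℕ → Fin d → ℝ} {w w' : WeightIndex L d → ℝ} (z : Fin d → ℝ)
    {k : ℕ} (hD : ∀ j < k, D j = D' j) (hw : ∀ j < k, weightMatrix w j = weightMatrix w' j) :
    gatedForward D w z k = gatedForward D' w' z k := by
  induction k with
  | zero => rfl
  | succ k ih =>
    simp only [gatedForward, hD k k.lt_succ_self, hw k k.lt_succ_self,
      ih (fun j hj => hD j (hj.trans k.lt_succ_self)) fun j hj => hw j (hj.trans k.lt_succ_self)]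

/-- The weights `w` with the layer of the entry `a` replaced by the matrix unit of `a`. The network
output is affine in each layer, so its derivative in direction `a` is its value at these weights. -/
noncomputable def setUnitLayer (a : WeightIndex L d) (w : WeightIndex L d → ℝ) :
    WeightIndex L d → ℝ :=
  fun b => if b.1 = a.1 then (Pi.single a 1 : WeightIndex L d → ℝ) b else w b

theorem weightMatrix_setUnitLayer_self (a : WeightIndex L d) (w : WeightIndex L d → ℝ) :
    weightMatrix (setUnitLayer a w) a.1 = Matrix.single a.2.1 a.2.2 1 := by
  obtain ⟨l, i, j⟩ := a
  ext i' j'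
  simp [weightMatrix, setUnitLayer, Matrix.single_apply, Pi.single_apply, eq_comm]

theorem weightMatrix_setUnitLayer_of_ne {a : WeightIndex L d} {k : ℕ} (h : k ≠ a.1)
    (w : WeightIndex L d → ℝ) : weightMatrix (setUnitLayer a w) k = weightMatrix w k := by
  ext i j
  have hne (hk : k < L) : (⟨k, hk⟩ : Fin L) ≠ a.1 := fun he => h (congrArg Fin.val he)
  simp [weightMatrix, setUnitLayer, hne]

theorem weightMatrix_add_smul_single_self (a : WeightIndex L d) (w : WeightIndex L d → ℝ) (t : ℝ) :
    weightMatrix (w + t • Pi.single a 1) a.1 =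
      weightMatrix w a.1 + t • Matrix.single a.2.1 a.2.2 1 := by
  obtain ⟨l, i, j⟩ := a
  ext i' j'
  simp [weightMatrix, Matrix.single_apply, Pi.single_apply, eq_comm]

theorem weightMatrix_add_smul_single_of_ne {a : WeightIndex L d} {k : ℕ} (h : k ≠ a.1)
    (w : WeightIndex L d → ℝ) (t : ℝ) :
    weightMatrix (w + t • Pi.single a 1) k = weightMatrix w k := by
  ext i j
  have hne (hk : k < L) : ((⟨k, hk⟩, i, j) : WeightIndex L d) ≠ a := fun he =>
    h (congrArg (fun b : WeightIndex L d => b.1.val) he)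
  simp [weightMatrix, hne]

theorem setUnitLayer_comm {a b : WeightIndex L d} (h : a.1 ≠ b.1) (w : WeightIndex L d → ℝ) :
    setUnitLayer a (setUnitLayer b w) = setUnitLayer b (setUnitLayer a w) := by
  ext c
  grind [setUnitLayer]

theorem setUnitLayer_add_smul_single_of_eq {a b : WeightIndex L d} (h : a.1 = b.1)
    (w : WeightIndex L d → ℝ) (t : ℝ) :
    setUnitLayer b (w + t • Pi.single a 1) = setUnitLayer b w := by
  ext c
  by_cases hc : c = a <;> simp [setUnitLayer, hc, h]

theorem setUnitLayer_add_smul_single_of_ne {a b : WeightIndex L d} (h : a.1 ≠ b.1)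
    (w : WeightIndex L d → ℝ) (t : ℝ) :
    setUnitLayer b (w + t • Pi.single a 1) = setUnitLayer b w + t • Pi.single a 1 := by
  ext c
  by_cases hc : c = a <;> by_cases hb : c.1 = b.1 <;> simp_all [setUnitLayer]

theorem gatedForward_add_smul_single_of_le (D : ℕ → Fin d → ℝ) (w : WeightIndex L d → ℝ)
    (z : Fin d → ℝ) {a : WeightIndex L d} {k : ℕ} (h : k ≤ a.1) (t : ℝ) :
    gatedForward D (w + t • Pi.single a 1) z k = gatedForward D w z k :=
  gatedForward_congr z (fun _ _ => rfl) fun _ hj =>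
    weightMatrix_add_smul_single_of_ne (hj.trans_le h).ne w t

theorem gatedForward_setUnitLayer_of_le (D : ℕ → Fin d → ℝ) (w : WeightIndex L d → ℝ)
    (z : Fin d → ℝ) {a : WeightIndex L d} {k : ℕ} (h : k ≤ a.1) :
    gatedForward D (setUnitLayer a w) z k = gatedForward D w z k :=
  gatedForward_congr z (fun _ _ => rfl) fun _ hj =>
    weightMatrix_setUnitLayer_of_ne (hj.trans_le h).ne w

theorem gatedForward_add_smul_single_of_lt (D : ℕ → Fin d → ℝ) (w : WeightIndex L d → ℝ)
    (z : Fin d → ℝ) {a : WeightIndex L d} {k : ℕ} (h : a.1 < k) (t : ℝ) :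
    gatedForward D (w + t • Pi.single a 1) z k =
      gatedForward D w z k + t • gatedForward D (setUnitLayer a w) z k := by
  induction k, h using Nat.le_induction with
  | base =>
    simp only [gatedForward, weightMatrix_add_smul_single_self, weightMatrix_setUnitLayer_self,
      gatedForward_add_smul_single_of_le D w z le_rfl, gatedForward_setUnitLayer_of_le D w z le_rfl,
      Matrix.add_mulVec, Matrix.smul_mulVec]
  | succ k hk ih =>
    have hne : k ≠ a.1 := (Nat.lt_of_succ_le hk).ne'
    simp only [gatedForward, weightMatrix_add_smul_single_of_ne hne,
      weightMatrix_setUnitLayer_of_ne hne, ih, ← Matrix.mulVec_smul, ← Matrix.mulVec_add]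
    congr 1
    ext j
    simp only [Pi.add_apply, Pi.smul_apply, smul_eq_mul]
    ring

end UnitLayer

section GatedOutput

variable {L d dout : ℕ}

/-- The network output `B Dᴸ Wᴸ Dᴸ⁻¹ ⋯ W¹ D⁰ z` with prescribed gates `D`, as a function of the
hidden weights. -/
def gatedOutput (B : Matrix (Fin dout) (Fin d) ℝ) (D : ℕ → Fin d → ℝ) (z : Fin d → ℝ)
    (w : WeightIndex L d → ℝ) : Fin dout → ℝ :=
  B *ᵥ fun j => D L j * gatedForward D w z L j

theorem contDiff_gatedForward (D : ℕ → Fin d → ℝ) (z : Fin d → ℝ) (k : ℕ) {r : WithTop ℕ∞} :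
    ContDiff ℝ r fun w : WeightIndex L d → ℝ => gatedForward D w z k := by
  induction k with
  | zero => exact contDiff_const
  | succ k ih =>
    refine contDiff_pi.mpr fun i => ?_
    simp only [gatedForward, Matrix.mulVec, dotProduct]
    refine ContDiff.sum fun j _ => ContDiff.mul ?_ ?_
    · by_cases h : k < L <;> simp only [weightMatrix, Matrix.of_apply, h, dite_true, dite_false] <;>
        fun_prop
    · exact contDiff_const.mul (contDiff_pi.mp ih j)

theorem contDiff_gatedOutput (B : Matrix (Fin dout) (Fin d) ℝ) (D : ℕ → Fin d → ℝ)
    (z : Fin d → ℝ) (o : Fin dout) {r : WithTop ℕ∞} :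
    ContDiff ℝ r fun w : WeightIndex L d → ℝ => gatedOutput B D z w o := by
  simp only [gatedOutput, Matrix.mulVec, dotProduct]
  exact ContDiff.sum fun j _ => contDiff_const.mul
    (contDiff_const.mul (contDiff_pi.mp (contDiff_gatedForward D z L) j))

theorem gatedOutput_add_smul_single (B : Matrix (Fin dout) (Fin d) ℝ) (D : ℕ → Fin d → ℝ)
    (z : Fin d → ℝ) (w : WeightIndex L d → ℝ) (a : WeightIndex L d) (t : ℝ) :
    gatedOutput B D z (w + t • Pi.single a 1) =
      gatedOutput B D z w + t • gatedOutput B D z (setUnitLayer a w) := by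
  simp only [gatedOutput, gatedForward_add_smul_single_of_lt D w z a.1.isLt, ← Matrix.mulVec_smul,
    ← Matrix.mulVec_add]
  congr 1
  ext j
  simp only [Pi.add_apply, Pi.smul_apply, smul_eq_mul]
  ring

theorem fderiv_gatedOutput (B : Matrix (Fin dout) (Fin d) ℝ) (D : ℕ → Fin d → ℝ)
    (z : Fin d → ℝ) (o : Fin dout) (w : WeightIndex L d → ℝ) (a : WeightIndex L d) :
    fderiv ℝ (fun w => gatedOutput B D z w o) w (Pi.single a 1) =
      gatedOutput B D z (setUnitLayer a w) o :=
  fderiv_apply_eq_of_forall_add_smul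
    ((contDiff_gatedOutput B D z o).differentiable one_ne_zero w) fun t => by
      simp [gatedOutput_add_smul_single]

theorem hessianMatrix_gatedOutput (B : Matrix (Fin dout) (Fin d) ℝ) (D : ℕ → Fin d → ℝ)
    (z : Fin d → ℝ) (o : Fin dout) (w : WeightIndex L d → ℝ) (a b : WeightIndex L d) :
    hessianMatrix (fun w => gatedOutput B D z w o) w a b =
      if a.1 = b.1 then 0 else gatedOutput B D z (setUnitLayer a (setUnitLayer b w)) o := by
  rw [hessianMatrix_apply (contDiff_gatedOutput B D z o)]
  simp only [fderiv_gatedOutput]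
  have hdiff : DifferentiableAt ℝ (fun w => gatedOutput B D z (setUnitLayer b w) o) w := by
    have hset : Differentiable ℝ (setUnitLayer b : (WeightIndex L d → ℝ) → _) :=
      differentiable_pi.mpr fun c => by
        by_cases h : c.1 = b.1 <;> simp only [setUnitLayer, h, if_true, if_false] <;> fun_prop
    exact ((contDiff_gatedOutput B D z o).differentiable one_ne_zero).comp hset w
  refine fderiv_apply_eq_of_forall_add_smul hdiff fun t => ?_
  split_ifs with h
  · simp [setUnitLayer_add_smul_single_of_eq h]
  · simp [setUnitLayer_add_smul_single_of_ne h, gatedOutput_add_smul_single]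

end GatedOutput

namespace Activation

theorem enorm_gate_le_one (act : Activation) (t : ℝ) : ‖act.gate t‖ₑ ≤ 1 := by
  cases act
  · simp [gate]
  · simp only [gate]
    split_ifs <;> simp

theorem enorm_gate_relu_sq_add_neg_le_one (t : ℝ) :
    ‖relu.gate t‖ₑ ^ 2 + ‖relu.gate (-t)‖ₑ ^ 2 ≤ 1 := by
  rcases lt_trichotomy t 0 with h | h | h <;> simp [gate, h, h.not_gt]

theorem measurable_gate (act : Activation) : Measurable act.gate := by
  cases act
  · exact measurable_const
  · exact Measurable.ite measurableSet_Ioi measurable_const measurable_const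

theorem continuous_fn (act : Activation) : Continuous act.fn := by
  cases act
  · exact continuous_id
  · exact continuous_id.max continuous_const

end Activation

/-- The properties of the weight law that bound the energy of a layer: `P` is a probability law
with mean zero and variance `σ ^ 2`, for ReLU networks moreover symmetric around zero. -/
structure IsWeightLaw (act : Activation) (P : Measure ℝ) (σ : ℝ) : Prop where
  isProbabilityMeasure : IsProbabilityMeasure P
  memLp_two : MemLp id 2 P
  integral_eq_zero : ∫ t, t ∂P = 0
  variance_eq : variance id P = σ ^ 2
  symmetric : act = .linear ∨ P.map (fun t => -t) = P

theorem IsInitLaw.integral_eq_zero {P : Measure ℝ} {σ : ℝ} (h : IsInitLaw P σ) :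
    ∫ t, t ∂P = 0 := by
  have hneg : ∫ t, t ∂P = -∫ t, t ∂P := by
    conv_lhs => rw [← h.symmetric]
    rw [integral_map (by fun_prop) (by fun_prop), integral_neg]
  linarith

theorem IsInitLaw.isWeightLaw {P : Measure ℝ} {σ : ℝ} (h : IsInitLaw P σ) (act : Activation) :
    IsWeightLaw act P σ :=
  have := h.isProbabilityMeasure
  ⟨this, h.fourth_moment.mono_exponent (by norm_num), h.integral_eq_zero, h.variance_eq,
    .inr h.symmetric⟩

section Moments

variable {ι : Type*} [Fintype ι] {P : Measure ℝ}

theorem lintegral_enorm_sum_mul_sq [IsProbabilityMeasure P] (hP : MemLp id 2 P)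
    (hmean : ∫ t, t ∂P = 0) (v : ι → ℝ) :
    ∫⁻ y : ι → ℝ, ‖∑ a, y a * v a‖ₑ ^ 2 ∂Measure.pi (fun _ => P) =
      ENNReal.ofReal (variance id P) * sqNorm v := by
  have hmem (a : ι) : MemLp (fun t : ℝ => t * v a) 2 P := hP.mul_const (v a)
  have hpi (a : ι) : MemLp (fun y : ι → ℝ => y a * v a) 2 (Measure.pi fun _ => P) :=
    (hmem a).comp_measurePreserving (measurePreserving_eval _ a)
  have hsum : (∑ a, fun y : ι → ℝ => y a * v a) = fun y => ∑ a, y a * v a := by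
    ext y
    exact Finset.sum_apply y _ _
  have hvar : variance (fun y : ι → ℝ => ∑ a, y a * v a) (Measure.pi fun _ => P) =
      variance id P * ∑ a, v a ^ 2 := by
    rw [← hsum, variance_sum_pi hmem, Finset.mul_sum]
    exact Finset.sum_congr rfl fun a _ => variance_mul_const (v a) id P
  have hzero : ∫ y : ι → ℝ, ∑ a, y a * v a ∂Measure.pi (fun _ => P) = 0 := by
    rw [integral_finsetSum _ fun a _ => (hpi a).integrable one_le_two]
    refine Finset.sum_eq_zero fun a _ => ?_
    have heval := integral_comp_eval (μ := fun _ : ι => P) (i := a) (f := id) (by fun_prop)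
    simp only [id_eq, hmean] at heval
    rw [integral_mul_const, heval, zero_mul]
  have hlint : ∫⁻ y : ι → ℝ, ‖∑ a, y a * v a‖ₑ ^ 2 ∂Measure.pi (fun _ => P) =
      evariance (fun y : ι → ℝ => ∑ a, y a * v a) (Measure.pi fun _ => P) := by
    simp [evariance, hzero]
  rw [hlint, ← ofReal_variance (memLp_finsetSum _ fun a _ => hpi a), hvar,
    ENNReal.ofReal_mul (variance_nonneg _ _), sqNorm_eq_ofReal]

/-- The weights `y` and `-y` have the same law, and the gate is open for at most one of them. -/
theorem lintegral_enorm_gate_relu_mul_sq_le [IsProbabilityMeasure P] (hP : MemLp id 2 P)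
    (hmean : ∫ t, t ∂P = 0) (hsymm : P.map (fun t => -t) = P) (u v : ι → ℝ) :
    ∫⁻ y : ι → ℝ, ‖Activation.relu.gate (∑ a, y a * u a) * ∑ a, y a * v a‖ₑ ^ 2
      ∂Measure.pi (fun _ => P) ≤ 2⁻¹ * (ENNReal.ofReal (variance id P) * sqNorm v) := by
  let F (y : ι → ℝ) : ℝ≥0∞ := ‖Activation.relu.gate (∑ a, y a * u a) * ∑ a, y a * v a‖ₑ ^ 2
  have hF : Measurable F :=
    (((Activation.measurable_gate _).comp (by fun_prop)).mul (by fun_prop)).enorm.pow_const 2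
  have hneg : ∫⁻ y, F (-y) ∂Measure.pi (fun _ => P) = ∫⁻ y, F y ∂Measure.pi (fun _ => P) :=
    (measurePreserving_pi (fun _ => P) (fun _ => P) (f := fun _ t => -t)
      fun _ => ⟨measurable_neg, hsymm⟩).lintegral_comp hF
  have hpair (y : ι → ℝ) : F y + F (-y) ≤ ‖∑ a, y a * v a‖ₑ ^ 2 := by
    simp only [F, Pi.neg_apply, neg_mul, Finset.sum_neg_distrib, enorm_neg, enorm_mul,
      mul_pow, ← add_mul]
    exact mul_le_of_le_one_left zero_le (Activation.enorm_gate_relu_sq_add_neg_le_one _)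
  rw [← ENNReal.div_eq_inv_mul, ENNReal.le_div_iff_mul_le (.inl two_ne_zero)
    (.inl ENNReal.ofNat_ne_top), mul_two, ← lintegral_enorm_sum_mul_sq hP hmean v]
  nth_rewrite 2 [← hneg]
  rw [← lintegral_add_left hF]
  exact lintegral_mono hpair

theorem lintegral_enorm_gate_mul_sq_le {act : Activation} {σ : ℝ} (hP : IsWeightLaw act P σ)
    (u v : ι → ℝ) :
    ∫⁻ y : ι → ℝ, ‖act.gate (∑ a, y a * u a) * ∑ a, y a * v a‖ₑ ^ 2 ∂Measure.pi (fun _ => P) ≤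
      ENNReal.ofReal (act.p * σ ^ 2) * sqNorm v := by
  have := hP.isProbabilityMeasure
  cases act with
  | linear =>
    simp only [Activation.gate, Activation.p, one_mul, ← hP.variance_eq]
    exact (lintegral_enorm_sum_mul_sq hP.memLp_two hP.integral_eq_zero v).le
  | relu =>
    have hsymm := hP.symmetric.resolve_left nofun
    have hhalf : ENNReal.ofReal (1 / 2) = 2⁻¹ := by
      rw [one_div, ENNReal.ofReal_inv_of_pos two_pos, ENNReal.ofReal_ofNat]
    rw [Activation.p, ENNReal.ofReal_mul (by norm_num), hhalf, mul_assoc, ← hP.variance_eq]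
    exact lintegral_enorm_gate_relu_mul_sq_le hP.memLp_two hP.integral_eq_zero hsymm u v

theorem lintegral_enorm_gate_mul_sq_le_of_dependsOn {act : Activation} {σ : ℝ}
    (hP : IsWeightLaw act P σ) (s : Finset ι) {u v : (ι → ℝ) → ι → ℝ} (hu : Measurable u)
    (hv : Measurable v) (hus : DependsOn u (sᶜ : Set ι)) (hvs : DependsOn v (sᶜ : Set ι)) :
    ∫⁻ w, ‖act.gate (∑ a ∈ s, w a * u w a) * ∑ a ∈ s, w a * v w a‖ₑ ^ 2
        ∂Measure.pi (fun _ => P) ≤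
      ∫⁻ w, ENNReal.ofReal (act.p * σ ^ 2) * ∑ a ∈ s, ‖v w a‖ₑ ^ 2 ∂Measure.pi (fun _ => P) := by
  classical
  have := hP.isProbabilityMeasure
  refine lintegral_le_of_lmarginal_le s ?_ (by fun_prop) fun w => ?_
  · exact ((act.measurable_gate.comp (by fun_prop)).mul (by fun_prop)).enorm.pow_const 2
  have hout (y : s → ℝ) : ∀ b ∈ (sᶜ : Set ι), Function.updateFinset w s y b = w b :=
    fun b hb => dif_neg (by simpa using hb)
  have hin (y : s → ℝ) (a : s) : Function.updateFinset w s y a = y a := by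
    simp [Function.updateFinset]
  simp only [lmarginal, fun y => hus (hout y), fun y => hvs (hout y), lintegral_const,
    measure_univ, mul_one, ← Finset.sum_coe_sort s, hin]
  exact lintegral_enorm_gate_mul_sq_le hP (fun a : s => u w a) (fun a : s => v w a)

end Moments

section GatedState

variable {L d : ℕ}

/-- The gates `Dᵏ` of the network with weights `w` at the network input `z`. -/
noncomputable def gates (act : Activation) (w : WeightIndex L d → ℝ) (z : Fin d → ℝ) (k : ℕ) :
    Fin d → ℝ :=
  fun j => act.gate (preact act w z k j)

/-- The gated activations `Dᵏ W'ᵏ Dᵏ⁻¹ ⋯ W'¹ D⁰ z` of the weights `w'`, with the gates produced by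
the weights `w`. -/
noncomputable def gatedState (act : Activation) (w : WeightIndex L d → ℝ) (z : Fin d → ℝ)
    (w' : WeightIndex L d → ℝ) (k : ℕ) : Fin d → ℝ :=
  fun j => gates act w z k j * gatedForward (gates act w z) w' z k j

theorem sqNorm_gates_mul_le (act : Activation) (w : WeightIndex L d → ℝ) (z : Fin d → ℝ) (k : ℕ)
    (v : Fin d → ℝ) : sqNorm (fun j => gates act w z k j * v j) ≤ sqNorm v := by
  refine Finset.sum_le_sum fun j _ => ?_
  rw [enorm_mul]
  gcongr
  exact mul_le_of_le_one_left zero_le (act.enorm_gate_le_one _)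

theorem weightMatrix_congr {w w' : WeightIndex L d → ℝ} {k : ℕ}
    (h : ∀ a : WeightIndex L d, a.1.val = k → w a = w' a) :
    weightMatrix w k = weightMatrix w' k := by
  ext i j
  by_cases hk : k < L
  · simpa [weightMatrix, hk] using h (⟨k, hk⟩, i, j) rfl
  · simp [weightMatrix, hk]

theorem dependsOn_preact (act : Activation) (z : Fin d → ℝ) (k : ℕ) :
    DependsOn (fun w : WeightIndex L d → ℝ => preact act w z k) {a | a.1.val < k} := by
  induction k with
  | zero => exact fun _ _ _ => rfl
  | succ k ih =>
    intro w w' h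
    have hpre : preact act w z k = preact act w' z k := ih fun a ha => h a (Nat.lt_succ_of_lt ha)
    have hweight : weightMatrix w k = weightMatrix w' k :=
      weightMatrix_congr fun a ha => h a (by simp [ha])
    simp only [preact, hpre, hweight]

theorem preact_add_smul_single_of_le (act : Activation) (w : WeightIndex L d → ℝ) (z : Fin d → ℝ)
    {a : WeightIndex L d} {k : ℕ} (h : k ≤ a.1) (t : ℝ) :
    preact act (w + t • Pi.single a 1) z k = preact act w z k :=
  dependsOn_preact act z k fun b hb => by
    have hne : b ≠ a := fun hba => (hba ▸ h).not_gt hb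
    simp [hne]

theorem continuous_weightMatrix (k : ℕ) :
    Continuous fun w : WeightIndex L d → ℝ => weightMatrix w k := by
  refine continuous_matrix fun i j => ?_
  by_cases h : k < L <;> simp only [weightMatrix, Matrix.of_apply, h, dite_true, dite_false] <;>
    fun_prop

theorem continuous_preact (act : Activation) (k : ℕ) :
    Continuous fun q : (WeightIndex L d → ℝ) × (Fin d → ℝ) => preact act q.1 q.2 k := by
  induction k with
  | zero => exact continuous_snd
  | succ k ih =>
    exact ((continuous_weightMatrix k).comp continuous_fst).matrix_mulVec
      (continuous_pi fun j => act.continuous_fn.comp ((continuous_apply j).comp ih))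

theorem continuous_gatedForward (k : ℕ) :
    Continuous fun q : (ℕ → Fin d → ℝ) × (WeightIndex L d → ℝ) × (Fin d → ℝ) =>
      gatedForward q.1 q.2.1 q.2.2 k := by
  induction k with
  | zero => exact continuous_snd.comp continuous_snd
  | succ k ih =>
    exact ((continuous_weightMatrix k).comp (by fun_prop)).matrix_mulVec
      (continuous_pi fun j => .mul (by fun_prop) ((continuous_apply j).comp ih))

theorem measurable_gates (act : Activation) :
    Measurable fun q : (WeightIndex L d → ℝ) × (Fin d → ℝ) => gates act q.1 q.2 :=
  measurable_pi_lambda _ fun k => measurable_pi_lambda _ fun j =>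
    act.measurable_gate.comp ((measurable_pi_apply j).comp (continuous_preact act k).measurable)

theorem measurable_gatedState (act : Activation) (k : ℕ) :
    Measurable fun q : (WeightIndex L d → ℝ) × (Fin d → ℝ) × (WeightIndex L d → ℝ) =>
      gatedState act q.1 q.2.1 q.2.2 k := by
  have hgates : Measurable fun q : (WeightIndex L d → ℝ) × (Fin d → ℝ) × (WeightIndex L d → ℝ) =>
      gates act q.1 q.2.1 := (measurable_gates act).comp (measurable_fst.prodMk measurable_snd.fst)
  have hforward : Measurable fun q : (WeightIndex L d → ℝ) × (Fin d → ℝ) × (WeightIndex L d → ℝ) =>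
      gatedForward (gates act q.1 q.2.1) q.2.2 q.2.1 k :=
    (continuous_gatedForward k).measurable.comp
      (hgates.prodMk (measurable_snd.snd.prodMk measurable_snd.fst))
  exact measurable_pi_lambda _ fun j => ((measurable_pi_apply j).comp
    ((measurable_pi_apply k).comp hgates)).mul ((measurable_pi_apply j).comp hforward)

theorem measurable_setUnitLayer (a : WeightIndex L d) :
    Measurable (setUnitLayer a : (WeightIndex L d → ℝ) → _) :=
  measurable_pi_lambda _ fun b => by
    by_cases h : b.1 = a.1 <;> simp only [setUnitLayer, h, if_true, if_false] <;> fun_prop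

end GatedState

section Layer

variable {L d : ℕ} {act : Activation} {P : Measure ℝ} {σ : ℝ} (hP : IsWeightLaw act P σ)
  (z : Fin d → ℝ) (l : Fin L) {v : (WeightIndex L d → ℝ) → Fin d → ℝ}
  (hv : Measurable v) (hdep : DependsOn v {a | a.1 < l})

include hP hv hdep

theorem lintegral_enorm_neuron_sq_le (i : Fin d) :
    ∫⁻ w, ‖gates act w z (l + 1) i * (weightMatrix w l *ᵥ v w) i‖ₑ ^ 2
        ∂Measure.pi (fun _ => P) ≤
      ENNReal.ofReal (act.p * σ ^ 2) * ∫⁻ w, sqNorm (v w) ∂Measure.pi (fun _ => P) := by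
  let row : Fin d ↪ WeightIndex L d := ⟨fun j => (l, i, j), fun j j' h => by simpa using h⟩
  have hrow (j : Fin d) : row j = (l, i, j) := rfl
  let u (w : WeightIndex L d → ℝ) (j : Fin d) : ℝ := act.fn (preact act w z l j)
  have hu : Measurable u := measurable_pi_lambda _ fun j => act.continuous_fn.measurable.comp
    ((measurable_pi_apply j).comp ((continuous_preact act l).measurable.comp
      (measurable_id.prodMk measurable_const)))
  have hearlier :
      {a : WeightIndex L d | a.1 < l} ⊆ ((Finset.univ.map row : Finset _) : Set _)ᶜ := by
    intro a ha
    simp only [Finset.coe_map, Finset.coe_univ, Set.image_univ, Set.mem_compl_iff, Set.mem_range]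
    rintro ⟨j, rfl⟩
    exact lt_irrefl l ha
  have hbound := lintegral_enorm_gate_mul_sq_le_of_dependsOn hP (Finset.univ.map row)
    (u := fun w a => u w a.2.2) (v := fun w a => v w a.2.2) (by fun_prop) (by fun_prop)
    (fun w w' h => by
      simp only [u, dependsOn_preact act z l fun a ha => h a (hearlier ha)])
    (fun w w' h => by simp only [hdep fun a ha => h a (hearlier ha)])
  simp only [Finset.sum_map] at hbound
  rw [lintegral_const_mul _ (by fun_prop)] at hbound
  refine le_of_eq_of_le (lintegral_congr fun w => ?_) hbound
  simp [gates, preact, Matrix.mulVec, dotProduct, weightMatrix, u, hrow]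

theorem lintegral_sqNorm_layer_le :
    ∫⁻ w, sqNorm (fun i => gates act w z (l + 1) i * (weightMatrix w l *ᵥ v w) i)
        ∂Measure.pi (fun _ => P) ≤
      ENNReal.ofReal (act.p * d * σ ^ 2) * ∫⁻ w, sqNorm (v w) ∂Measure.pi (fun _ => P) := by
  have hmeas (i : Fin d) : Measurable fun w : WeightIndex L d → ℝ =>
      ‖gates act w z (l + 1) i * (weightMatrix w l *ᵥ v w) i‖ₑ ^ 2 := by
    have hgates : Measurable fun w : WeightIndex L d → ℝ => gates act w z (l + 1) i :=
      (measurable_pi_apply i).comp ((measurable_pi_apply _).comp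
        ((measurable_gates act).comp (measurable_id.prodMk measurable_const)))
    have hmul : Measurable fun w : WeightIndex L d → ℝ => (weightMatrix w l *ᵥ v w) i :=
      Finset.measurable_sum Finset.univ fun j _ => ((continuous_apply_apply i j).comp
        (continuous_weightMatrix l)).measurable.mul ((measurable_pi_apply j).comp hv)
    exact (hgates.mul hmul).enorm.pow_const 2
  change ∫⁻ w, ∑ i, _ ∂_ ≤ _
  rw [lintegral_finsetSum _ fun i _ => hmeas i]
  refine (Finset.sum_le_sum fun i _ => lintegral_enorm_neuron_sq_le hP z l hv hdep i).trans_eq ?_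
  rw [Finset.sum_const, Finset.card_univ, Fintype.card_fin, nsmul_eq_mul, ← mul_assoc,
    ← ENNReal.ofReal_natCast, ← ENNReal.ofReal_mul (by positivity), mul_left_comm, mul_assoc]

end Layer

section StateEnergy

variable {L d : ℕ} {τ : (WeightIndex L d → ℝ) → WeightIndex L d → ℝ}

/-- A measurable transformation of the weights under which every layer depends only on the same and
the earlier layers. The layer matrices it leaves alone are then independent of its earlier layers,
so that the energy of such a network can be bounded layer by layer. -/
structure IsLayerwise (τ : (WeightIndex L d → ℝ) → WeightIndex L d → ℝ) : Prop where
  measurable : Measurable τ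
  dependsOn : ∀ a, DependsOn (fun w => τ w a) {b | b.1 ≤ a.1}

theorem isLayerwise_id : IsLayerwise (id : (WeightIndex L d → ℝ) → _) :=
  ⟨measurable_id, fun a _ _ h => h a (le_refl a.1)⟩

theorem IsLayerwise.setUnitLayer_comp (hτ : IsLayerwise τ) (c : WeightIndex L d) :
    IsLayerwise (setUnitLayer c ∘ τ) := by
  refine ⟨(measurable_setUnitLayer c).comp hτ.measurable, fun a w w' h => ?_⟩
  have hτa : τ w a = τ w' a := hτ.dependsOn a h
  simp only [Function.comp_apply, setUnitLayer, hτa]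

theorem isLayerwise_setUnitLayer (c : WeightIndex L d) : IsLayerwise (setUnitLayer c) :=
  isLayerwise_id.setUnitLayer_comp c

theorem IsLayerwise.dependsOn_gatedState (hτ : IsLayerwise τ) (act : Activation)
    (z : Fin d → ℝ) (k : ℕ) :
    DependsOn (fun w => gatedState act w z (τ w) k) {a | a.1.val < k} := by
  intro w w' h
  have hgates : ∀ j ≤ k, gates act w z j = gates act w' z j := fun j hj => by
    have hpreact : preact act w z j = preact act w' z j :=
      dependsOn_preact act z j fun a ha => h a (lt_of_lt_of_le ha hj)
    ext i
    simp only [gates, hpreact]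
  have hweight : ∀ j < k, weightMatrix (τ w) j = weightMatrix (τ w') j := fun j hj =>
    weightMatrix_congr fun a ha => hτ.dependsOn a fun b hb =>
      h b (lt_of_le_of_lt (Fin.le_def.mp hb) (ha.trans_lt hj))
  ext i
  simp only [gatedState, hgates k le_rfl,
    gatedForward_congr z (fun j hj => hgates j hj.le) hweight]

theorem IsLayerwise.measurable_gatedState (hτ : IsLayerwise τ) (act : Activation) (z : Fin d → ℝ)
    (k : ℕ) : Measurable fun w => gatedState act w z (τ w) k :=
  (_root_.measurable_gatedState act k).comp
    (measurable_id.prodMk (measurable_const.prodMk hτ.measurable))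

theorem IsLayerwise.measurable_sqNorm_gatedState (hτ : IsLayerwise τ) (act : Activation)
    (z : Fin d → ℝ) (k : ℕ) : Measurable fun w => sqNorm (gatedState act w z (τ w) k) :=
  continuous_sqNorm.measurable.comp (hτ.measurable_gatedState act z k)

theorem gatedState_succ (act : Activation) (w : WeightIndex L d → ℝ) (z : Fin d → ℝ)
    (w' : WeightIndex L d → ℝ) (k : ℕ) :
    gatedState act w z w' (k + 1) =
      fun i => gates act w z (k + 1) i * (weightMatrix w' k *ᵥ gatedState act w z w' k) i := rfl

/-- The second moment of the activations at layer `k`, with the gates of the random weights `w` and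
the layer matrices of `τ w`. -/
noncomputable def stateEnergy (act : Activation) (P : Measure ℝ) (z : Fin d → ℝ)
    (τ : (WeightIndex L d → ℝ) → WeightIndex L d → ℝ) (k : ℕ) : ℝ≥0∞ :=
  ∫⁻ w, sqNorm (gatedState act w z (τ w) k) ∂Measure.pi fun _ => P

variable {act : Activation} {P : Measure ℝ} {σ : ℝ} (hP : IsWeightLaw act P σ) (z : Fin d → ℝ)

include hP

theorem IsLayerwise.stateEnergy_le_pow_mul (hτ : IsLayerwise τ) {k k' : ℕ} (hk : k ≤ k')
    (hL : k' ≤ L) (h : ∀ j, k ≤ j → j < k' → ∀ w, weightMatrix (τ w) j = weightMatrix w j) :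
    stateEnergy act P z τ k' ≤
      ENNReal.ofReal (act.p * d * σ ^ 2) ^ (k' - k) * stateEnergy act P z τ k := by
  induction k', hk using Nat.le_induction with
  | base => simp
  | succ m hm ih =>
    have hlayer := lintegral_sqNorm_layer_le hP z ⟨m, hL⟩ (hτ.measurable_gatedState act z m)
      (hτ.dependsOn_gatedState act z m)
    calc stateEnergy act P z τ (m + 1)
        ≤ ENNReal.ofReal (act.p * d * σ ^ 2) * stateEnergy act P z τ m := by
          refine le_of_eq_of_le (lintegral_congr fun w => ?_) hlayer
          rw [gatedState_succ, h m hm m.lt_succ_self]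
      _ ≤ _ := by
          rw [Nat.succ_sub hm, pow_succ' _ (m - k), mul_assoc (ENNReal.ofReal _)]
          gcongr
          exact ih (Nat.le_of_succ_le hL) fun j hj hjm => h j hj (hjm.trans m.lt_succ_self)

theorem stateEnergy_id_le {k : ℕ} (hk : k ≤ L) :
    stateEnergy act P z (id : (WeightIndex L d → ℝ) → _) k ≤
      ENNReal.ofReal (act.p * d * σ ^ 2) ^ k * sqNorm z := by
  have := hP.isProbabilityMeasure
  refine (isLayerwise_id.stateEnergy_le_pow_mul hP z k.zero_le hk fun _ _ _ _ => rfl).trans ?_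
  rw [Nat.sub_zero]
  gcongr
  calc stateEnergy act P z (id : (WeightIndex L d → ℝ) → _) 0
      ≤ ∫⁻ _ : WeightIndex L d → ℝ, sqNorm z ∂Measure.pi (fun _ => P) :=
        lintegral_mono fun w => sqNorm_gates_mul_le act w z 0 z
    _ = sqNorm z := by simp

omit hP

theorem sqNorm_single_mulVec (i j : Fin d) (v : Fin d → ℝ) :
    sqNorm (Matrix.single i j 1 *ᵥ v) = ‖v j‖ₑ ^ 2 := by
  rw [sqNorm, Finset.sum_eq_single i]
  · simp [Matrix.single_mulVec]
  · intro b _ hb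
    simp [Matrix.single_mulVec, hb]
  · simp

theorem sum_sqNorm_gatedState_setUnitLayer_le (w w' : WeightIndex L d → ℝ) (l : Fin L) :
    ∑ c : Fin d × Fin d, sqNorm (gatedState act w z (setUnitLayer (l, c) w') (l + 1)) ≤
      d * sqNorm (gatedState act w z w' l) := by
  have hc (c : Fin d × Fin d) :
      sqNorm (gatedState act w z (setUnitLayer (l, c) w') (l + 1)) ≤
        ‖gatedState act w z w' l c.2‖ₑ ^ 2 := by
    have hstate : gatedState act w z (setUnitLayer (l, c) w') l = gatedState act w z w' l := by
      ext i
      simp only [gatedState, gatedForward_setUnitLayer_of_le (a := (l, c)) _ w' z le_rfl]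
    rw [gatedState_succ, hstate, weightMatrix_setUnitLayer_self (l, c), ← sqNorm_single_mulVec c.1]
    exact sqNorm_gates_mul_le act w z _ _
  refine (Finset.sum_le_sum fun c _ => hc c).trans_eq ?_
  simp [Fintype.sum_prod_type, sqNorm]

include hP

theorem IsLayerwise.sum_stateEnergy_setUnitLayer_le (hτ : IsLayerwise τ) (l : Fin L) {k : ℕ}
    (hl : l < k) (hk : k ≤ L)
    (h : ∀ j : ℕ, l < j → j < k → ∀ w, weightMatrix (τ w) j = weightMatrix w j) :
    ∑ c : Fin d × Fin d, stateEnergy act P z (setUnitLayer (l, c) ∘ τ) k ≤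
      ENNReal.ofReal (act.p * d * σ ^ 2) ^ (k - (l + 1)) * (d * stateEnergy act P z τ l) := by
  calc ∑ c : Fin d × Fin d, stateEnergy act P z (setUnitLayer (l, c) ∘ τ) k
      ≤ ∑ c : Fin d × Fin d, ENNReal.ofReal (act.p * d * σ ^ 2) ^ (k - (l + 1)) *
          stateEnergy act P z (setUnitLayer (l, c) ∘ τ) (l + 1) :=
        Finset.sum_le_sum fun c _ => (hτ.setUnitLayer_comp _).stateEnergy_le_pow_mul hP z hl hk
          fun j hj hjk w => by
            rw [Function.comp_apply, weightMatrix_setUnitLayer_of_ne (Nat.lt_of_succ_le hj).ne']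
            exact h j hj hjk w
    _ ≤ _ := by
        rw [← Finset.mul_sum]
        gcongr
        simp only [stateEnergy]
        rw [← lintegral_finsetSum _ fun c _ =>
            (hτ.setUnitLayer_comp (l, c)).measurable_sqNorm_gatedState act z _,
          ← lintegral_const_mul _ (hτ.measurable_sqNorm_gatedState act z l)]
        exact lintegral_mono fun w => sum_sqNorm_gatedState_setUnitLayer_le z w (τ w) l

theorem sum_stateEnergy_setUnitLayer_le (l : Fin L) {k : ℕ} (hl : l < k) (hk : k ≤ L) :
    ∑ c : Fin d × Fin d, stateEnergy act P z (setUnitLayer (l, c)) k ≤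
      d * ENNReal.ofReal (act.p * d * σ ^ 2) ^ (k - 1) * sqNorm z := by
  refine (isLayerwise_id.sum_stateEnergy_setUnitLayer_le hP z l hl hk
    fun _ _ _ _ => rfl).trans ?_
  calc _ ≤ ENNReal.ofReal (act.p * d * σ ^ 2) ^ (k - (l + 1)) *
        (d * (ENNReal.ofReal (act.p * d * σ ^ 2) ^ l.val * sqNorm z)) := by
        gcongr
        exact stateEnergy_id_le hP z l.isLt.le
    _ = _ := by
        rw [show k - 1 = (k - (l + 1)) + l by omega, pow_add]
        ring

theorem sum_stateEnergy_setUnitLayer_setUnitLayer_le_of_lt {l m : Fin L} (hlm : l < m) :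
    ∑ c : Fin d × Fin d, ∑ c' : Fin d × Fin d,
        stateEnergy act P z (setUnitLayer (m, c') ∘ setUnitLayer (l, c)) L ≤
      d ^ 2 * ENNReal.ofReal (act.p * d * σ ^ 2) ^ (L - 2) * sqNorm z := by
  calc _ ≤ ∑ c : Fin d × Fin d, ENNReal.ofReal (act.p * d * σ ^ 2) ^ (L - (m + 1)) *
        (d * stateEnergy act P z (setUnitLayer (l, c)) m) :=
        Finset.sum_le_sum fun c _ => (isLayerwise_setUnitLayer
          (l, c)).sum_stateEnergy_setUnitLayer_le hP z m m.isLt le_rfl fun j hj _ w =>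
            weightMatrix_setUnitLayer_of_ne ((Fin.lt_def.mp hlm).trans hj).ne' w
    _ ≤ ENNReal.ofReal (act.p * d * σ ^ 2) ^ (L - (m + 1)) * (d *
        (d * ENNReal.ofReal (act.p * d * σ ^ 2) ^ (m.val - 1) * sqNorm z)) := by
        rw [← Finset.mul_sum, ← Finset.mul_sum]
        gcongr
        exact sum_stateEnergy_setUnitLayer_le hP z l hlm m.isLt.le
    _ = _ := by
        rw [show L - 2 = (L - (m + 1)) + (m - 1) by have := m.isLt; omega, pow_add]
        ring

theorem sum_stateEnergy_setUnitLayer_setUnitLayer_le {l m : Fin L} (hlm : l ≠ m) :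
    ∑ c : Fin d × Fin d, ∑ c' : Fin d × Fin d,
        stateEnergy act P z (setUnitLayer (l, c) ∘ setUnitLayer (m, c')) L ≤
      d ^ 2 * ENNReal.ofReal (act.p * d * σ ^ 2) ^ (L - 2) * sqNorm z := by
  have hcomm (c c' : Fin d × Fin d) :
      setUnitLayer (l, c) ∘ setUnitLayer (m, c') = setUnitLayer (m, c') ∘ setUnitLayer (l, c) :=
    funext fun w => setUnitLayer_comm hlm w
  rcases lt_or_gt_of_ne hlm with h | h
  · simp only [hcomm]
    exact sum_stateEnergy_setUnitLayer_setUnitLayer_le_of_lt hP z h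
  · rw [Finset.sum_comm]
    exact sum_stateEnergy_setUnitLayer_setUnitLayer_le_of_lt hP z h

end StateEnergy

section Energy

variable {L d : ℕ}

/-- The squared norm of the gated activations at the last layer; times `‖B‖²` it bounds the squared
network output. -/
noncomputable def outputEnergy (act : Activation) (w : WeightIndex L d → ℝ) (z : Fin d → ℝ) :
    ℝ≥0∞ :=
  sqNorm (gatedState act w z w L)

/-- The squared norm of the derivative of the gated activations at the last layer. -/
noncomputable def gradEnergy (act : Activation) (w : WeightIndex L d → ℝ) (z : Fin d → ℝ) :
    ℝ≥0∞ :=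
  ∑ a, sqNorm (gatedState act w z (setUnitLayer a w) L)

/-- The squared norm of the second derivative of the gated activations at the last layer. -/
noncomputable def hessEnergy (act : Activation) (w : WeightIndex L d → ℝ) (z : Fin d → ℝ) :
    ℝ≥0∞ :=
  ∑ a : WeightIndex L d, ∑ b : WeightIndex L d, if a.1 = b.1 then 0 else
    sqNorm (gatedState act w z (setUnitLayer a (setUnitLayer b w)) L)

/-- The contribution of the network input `z` to the bound on the Hessian, up to the factor `‖B‖²`;
the weight `c` balances the residual against the second derivative of the output. -/
noncomputable def sampleEnergy (act : Activation) (c : ℝ≥0∞) (w : WeightIndex L d → ℝ)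
    (z : Fin d → ℝ) : ℝ≥0∞ :=
  gradEnergy act w z + c * outputEnergy act w z + 2 * c⁻¹ * hessEnergy act w z

theorem networkHessian_eq (act : Activation) {din dout n : ℕ} (A : Matrix (Fin d) (Fin din) ℝ)
    (B : Matrix (Fin dout) (Fin d) ℝ) (x : Fin n → Fin din → ℝ) (y : Fin n → Fin dout → ℝ)
    (w : WeightIndex L d → ℝ) :
    let f (q : Fin n × Fin dout) (w' : WeightIndex L d → ℝ) : ℝ :=
      gatedOutput B (gates act w (A *ᵥ x q.1)) (A *ᵥ x q.1) w' q.2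
    networkHessian act A B x y w = (n : ℝ)⁻¹ • ∑ q : Fin n × Fin dout,
      (Matrix.vecMulVec (fun a => f q (setUnitLayer a w)) (fun a => f q (setUnitLayer a w)) -
        (y q.1 q.2 - f q w) • hessianMatrix (f q) w) := by
  intro f
  have hloss : gatedLoss act A B x y w = fun w' =>
      1 / (2 * (n : ℝ)) * ∑ q : Fin n × Fin dout, (y q.1 q.2 - f q w') ^ 2 := by
    ext w'
    rw [Fintype.sum_prod_type]
    rfl
  have hn : 2 * (1 / (2 * (n : ℝ))) = (n : ℝ)⁻¹ := by ring
  have hf (q : Fin n × Fin dout) : ContDiff ℝ 2 (f q) := contDiff_gatedOutput B _ _ q.2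
  rw [networkHessian, hloss, hessianMatrix_const_mul_sum_sq_sub _ _ hf, hn]
  simp only [f, fderiv_gatedOutput]

theorem sum_enorm_gatedOutput_sq_le (act : Activation) {dout : ℕ} (B : Matrix (Fin dout) (Fin d) ℝ)
    (w : WeightIndex L d → ℝ) (z : Fin d → ℝ) (w' : WeightIndex L d → ℝ) :
    ∑ o, ‖gatedOutput B (gates act w z) z w' o‖ₑ ^ 2 ≤
      (∑ o, sqNorm (B o)) * sqNorm (gatedState act w z w' L) :=
  sqNorm_mulVec_le B (gatedState act w z w' L)

theorem sum_sqNorm_hessianMatrix_gatedOutput_le (act : Activation) {dout : ℕ}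
    (B : Matrix (Fin dout) (Fin d) ℝ) (w : WeightIndex L d → ℝ) (z : Fin d → ℝ) :
    ∑ o, ∑ a, sqNorm (hessianMatrix (fun w' => gatedOutput B (gates act w z) z w' o) w a) ≤
      (∑ o, sqNorm (B o)) * hessEnergy act w z := by
  rw [Finset.sum_comm, hessEnergy, Finset.mul_sum]
  refine Finset.sum_le_sum fun a _ => ?_
  simp only [sqNorm, hessianMatrix_gatedOutput]
  rw [Finset.sum_comm, Finset.mul_sum]
  refine Finset.sum_le_sum fun b _ => ?_
  split_ifs
  · simp
  · exact sum_enorm_gatedOutput_sq_le act B w z _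

theorem spectralRadius_networkHessian_le (act : Activation) {din dout n : ℕ}
    (A : Matrix (Fin d) (Fin din) ℝ) (B : Matrix (Fin dout) (Fin d) ℝ)
    (x : Fin n → Fin din → ℝ) (y : Fin n → Fin dout → ℝ) (w : WeightIndex L d → ℝ)
    {c : ℝ≥0∞} (h0 : c ≠ 0) (htop : c ≠ ⊤) :
    spectralRadius ℝ (networkHessian act A B x y w) ≤ (n : ℝ≥0∞)⁻¹ * ∑ i,
      (c * sqNorm (y i) + (∑ o, sqNorm (B o)) * sampleEnergy act c w (A *ᵥ x i)) := by
  rcases eq_or_ne n 0 with rfl | hn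
  · simp [networkHessian_eq]
  have hninv : ‖(n : ℝ)⁻¹‖ₑ = (n : ℝ≥0∞)⁻¹ := by
    rw [enorm_inv (Nat.cast_ne_zero.mpr hn)]
    simp
  rw [networkHessian_eq]
  refine (spectralRadius_smul_sum_vecMulVec_sub_le h0 htop _ _ _ _ _).trans ?_
  rw [hninv, Fintype.sum_prod_type]
  gcongr with i
  set z := A *ᵥ x i
  have hgrad : ∑ o, sqNorm (fun a => gatedOutput B (gates act w z) z (setUnitLayer a w) o) ≤
      (∑ o, sqNorm (B o)) * gradEnergy act w z := by
    simp only [sqNorm]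
    rw [Finset.sum_comm, gradEnergy, Finset.mul_sum]
    exact Finset.sum_le_sum fun a _ => sum_enorm_gatedOutput_sq_le act B w z _
  have houtput : ∑ o, ‖gatedOutput B (gates act w z) z w o‖ₑ ^ 2 ≤
      (∑ o, sqNorm (B o)) * outputEnergy act w z := sum_enorm_gatedOutput_sq_le act B w z w
  have hhess := sum_sqNorm_hessianMatrix_gatedOutput_le act B w z
  simp only [Finset.sum_add_distrib, ← Finset.mul_sum, mul_add]
  calc _ ≤ (∑ o, sqNorm (B o)) * gradEnergy act w z +
        (c * sqNorm (y i) + c * ((∑ o, sqNorm (B o)) * outputEnergy act w z)) +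
        2 * c⁻¹ * ((∑ o, sqNorm (B o)) * hessEnergy act w z) := by
        gcongr
        exact le_rfl
    _ = _ := by
        rw [sampleEnergy]
        ring

theorem measurable_sqNorm_gatedState (act : Activation)
    {τ : (WeightIndex L d → ℝ) → WeightIndex L d → ℝ} (hτ : Measurable τ) :
    Measurable fun q : (WeightIndex L d → ℝ) × (Fin d → ℝ) =>
      sqNorm (gatedState act q.1 q.2 (τ q.1) L) :=
  continuous_sqNorm.measurable.comp ((measurable_gatedState act L).comp
    (measurable_fst.prodMk (measurable_snd.prodMk (hτ.comp measurable_fst))))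

theorem measurable_outputEnergy (act : Activation) :
    Measurable (Function.uncurry (outputEnergy (L := L) (d := d) act)) :=
  measurable_sqNorm_gatedState act (τ := id) measurable_id

theorem measurable_gradEnergy (act : Activation) :
    Measurable (Function.uncurry (gradEnergy (L := L) (d := d) act)) :=
  Finset.measurable_sum Finset.univ fun a _ =>
    measurable_sqNorm_gatedState act (τ := setUnitLayer a) (measurable_setUnitLayer a)

theorem measurable_hessEnergy (act : Activation) :
    Measurable (Function.uncurry (hessEnergy (L := L) (d := d) act)) := by
  refine Finset.measurable_sum Finset.univ fun a _ =>
    Finset.measurable_sum Finset.univ fun b _ => ?_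
  split_ifs
  · exact measurable_const
  · exact measurable_sqNorm_gatedState act (τ := setUnitLayer a ∘ setUnitLayer b)
      ((measurable_setUnitLayer a).comp (measurable_setUnitLayer b))

theorem measurable_sampleEnergy (act : Activation) (c : ℝ≥0∞) :
    Measurable (Function.uncurry (sampleEnergy (L := L) (d := d) act c)) :=
  ((measurable_gradEnergy act).add ((measurable_outputEnergy act).const_mul c)).add
    ((measurable_hessEnergy act).const_mul _)

end Energy

section ExpectedEnergy

variable {L d : ℕ} {act : Activation} {P : Measure ℝ} {σ : ℝ} (hP : IsWeightLaw act P σ)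
  (z : Fin d → ℝ)

include hP

theorem lintegral_outputEnergy_le :
    ∫⁻ w : WeightIndex L d → ℝ, outputEnergy act w z ∂Measure.pi (fun _ => P) ≤
      ENNReal.ofReal (act.p * d * σ ^ 2) ^ L * sqNorm z :=
  stateEnergy_id_le hP z le_rfl

theorem mul_lintegral_gradEnergy_le :
    ENNReal.ofReal (act.p * d * σ ^ 2) *
        ∫⁻ w : WeightIndex L d → ℝ, gradEnergy act w z ∂Measure.pi (fun _ => P) ≤
      L * d * ENNReal.ofReal (act.p * d * σ ^ 2) ^ L * sqNorm z := by
  set S := ENNReal.ofReal (act.p * d * σ ^ 2)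
  have hlayer (l : Fin L) :
      S * ∑ c : Fin d × Fin d, stateEnergy act P z (setUnitLayer (l, c)) L ≤
        d * S ^ L * sqNorm z := by
    calc _ ≤ S * (d * S ^ (L - 1) * sqNorm z) := by
          gcongr
          exact sum_stateEnergy_setUnitLayer_le hP z l l.isLt le_rfl
      _ = d * (S ^ (L - 1) * S) * sqNorm z := by ring
      _ = _ := by rw [← pow_succ, Nat.sub_add_cancel (Nat.one_le_of_lt l.isLt)]
  simp only [gradEnergy]
  rw [lintegral_finsetSum _ fun a _ =>
    (isLayerwise_setUnitLayer a).measurable_sqNorm_gatedState act z L, Fintype.sum_prod_type,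
    Finset.mul_sum]
  calc _ ≤ ∑ _l : Fin L, d * S ^ L * sqNorm z := Finset.sum_le_sum fun l _ => hlayer l
    _ = _ := by
        rw [Finset.sum_const, Finset.card_univ, Fintype.card_fin, nsmul_eq_mul]
        ring

omit hP in
theorem lintegral_hessEnergy_eq :
    ∫⁻ w : WeightIndex L d → ℝ, hessEnergy act w z ∂Measure.pi (fun _ => P) =
      ∑ l : Fin L, ∑ m : Fin L, if l = m then 0 else ∑ c : Fin d × Fin d, ∑ c' : Fin d × Fin d,
        stateEnergy act P z (setUnitLayer (l, c) ∘ setUnitLayer (m, c')) L := by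
  let F (a b : WeightIndex L d) (w : WeightIndex L d → ℝ) : ℝ≥0∞ := if a.1 = b.1 then 0 else
    sqNorm (gatedState act w z (setUnitLayer a (setUnitLayer b w)) L)
  have hmeas (a b : WeightIndex L d) : Measurable (F a b) := by
    simp only [F]
    split_ifs
    · exact measurable_const
    · exact ((isLayerwise_setUnitLayer b).setUnitLayer_comp a).measurable_sqNorm_gatedState act z L
  calc ∫⁻ w : WeightIndex L d → ℝ, hessEnergy act w z ∂Measure.pi (fun _ => P)
      = ∑ a, ∑ b, ∫⁻ w, F a b w ∂Measure.pi (fun _ => P) := by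
        refine (lintegral_finsetSum _ fun a _ => Finset.measurable_sum _ fun b _ =>
          hmeas a b).trans (Finset.sum_congr rfl fun a _ => ?_)
        exact lintegral_finsetSum _ fun b _ => hmeas a b
    _ = ∑ l, ∑ m, ∑ c : Fin d × Fin d, ∑ c' : Fin d × Fin d,
          ∫⁻ w, F (l, c) (m, c') w ∂Measure.pi (fun _ => P) := by
        simp only [Fintype.sum_prod_type (α₁ := Fin L)]
        exact Finset.sum_congr rfl fun l _ => Finset.sum_comm
    _ = _ := by
        refine Finset.sum_congr rfl fun l _ => Finset.sum_congr rfl fun m _ => ?_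
        split_ifs with hlm
        · simp [F, hlm]
        · simp [F, hlm, stateEnergy]

theorem sq_mul_lintegral_hessEnergy_le :
    ENNReal.ofReal (act.p * d * σ ^ 2) ^ 2 *
        ∫⁻ w : WeightIndex L d → ℝ, hessEnergy act w z ∂Measure.pi (fun _ => P) ≤
      L ^ 2 * d ^ 2 * ENNReal.ofReal (act.p * d * σ ^ 2) ^ L * sqNorm z := by
  set S := ENNReal.ofReal (act.p * d * σ ^ 2)
  have hpair (l m : Fin L) : S ^ 2 * (if l = m then 0 else ∑ c : Fin d × Fin d,
      ∑ c' : Fin d × Fin d, stateEnergy act P z (setUnitLayer (l, c) ∘ setUnitLayer (m, c')) L) ≤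
        d ^ 2 * S ^ L * sqNorm z := by
    split_ifs with hlm
    · simp
    have hL : 2 ≤ L := by omega
    calc _ ≤ S ^ 2 * (d ^ 2 * S ^ (L - 2) * sqNorm z) := by
          gcongr
          exact sum_stateEnergy_setUnitLayer_setUnitLayer_le hP z hlm
      _ = d ^ 2 * (S ^ (L - 2) * S ^ 2) * sqNorm z := by ring
      _ = _ := by rw [← pow_add, Nat.sub_add_cancel hL]
  simp only [lintegral_hessEnergy_eq, Finset.mul_sum (Finset.univ : Finset (Fin L))]
  calc _ ≤ ∑ _l : Fin L, ∑ _m : Fin L, d ^ 2 * S ^ L * sqNorm z :=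
        Finset.sum_le_sum fun l _ => Finset.sum_le_sum fun m _ => hpair l m
    _ = _ := by
        simp only [Finset.sum_const, Finset.card_univ, Fintype.card_fin, nsmul_eq_mul]
        ring

omit hP in
theorem lintegral_sampleEnergy_eq (c : ℝ≥0∞) :
    ∫⁻ w : WeightIndex L d → ℝ, sampleEnergy act c w z ∂Measure.pi (fun _ => P) =
      ∫⁻ w : WeightIndex L d → ℝ, gradEnergy act w z ∂Measure.pi (fun _ => P) +
        c * ∫⁻ w : WeightIndex L d → ℝ, outputEnergy act w z ∂Measure.pi (fun _ => P) +
        2 * c⁻¹ * ∫⁻ w : WeightIndex L d → ℝ, hessEnergy act w z ∂Measure.pi (fun _ => P) := by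
  have hgrad : Measurable fun w : WeightIndex L d → ℝ => gradEnergy act w z :=
    (measurable_gradEnergy act).of_uncurry_right
  have houtput : Measurable fun w : WeightIndex L d → ℝ => outputEnergy act w z :=
    (measurable_outputEnergy act).of_uncurry_right
  have hhess : Measurable fun w : WeightIndex L d → ℝ => hessEnergy act w z :=
    (measurable_hessEnergy act).of_uncurry_right
  simp only [sampleEnergy]
  rw [lintegral_add_left (hgrad.fun_add (houtput.const_mul c)), lintegral_add_left hgrad,
    lintegral_const_mul c houtput, lintegral_const_mul _ hhess]

/-- The weight `c = L d Q` balances the outer two of the three energies: both become of order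
`L d Q`. -/
theorem lintegral_sampleEnergy_le {Q : ℝ≥0∞} (hS : ENNReal.ofReal (act.p * d * σ ^ 2) ≠ 0)
    (hQ : Q ^ 2 = ENNReal.ofReal (act.p * d * σ ^ 2) ^ L) :
    ∫⁻ w : WeightIndex L d → ℝ, sampleEnergy act (L * d * Q) w z ∂Measure.pi (fun _ => P) ≤
      L * d * Q * ((ENNReal.ofReal (act.p * d * σ ^ 2))⁻¹ * Q + Q ^ 2 +
        2 * (ENNReal.ofReal (act.p * d * σ ^ 2))⁻¹ ^ 2) * sqNorm z := by
  set S := ENNReal.ofReal (act.p * d * σ ^ 2)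
  set c : ℝ≥0∞ := L * d * Q with hc
  have hgrad := (ENNReal.mul_le_iff_le_inv hS ENNReal.ofReal_ne_top).mp
    (mul_lintegral_gradEnergy_le (L := L) hP z)
  have hhess := (ENNReal.mul_le_iff_le_inv (pow_ne_zero 2 hS)
    (ENNReal.pow_ne_top ENNReal.ofReal_ne_top)).mp (sq_mul_lintegral_hessEnergy_le (L := L) hP z)
  have houtput := lintegral_outputEnergy_le (L := L) hP z
  rw [lintegral_sampleEnergy_eq]
  calc _ ≤ S⁻¹ * (L * d * Q ^ 2 * sqNorm z) + c * (Q ^ 2 * sqNorm z) +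
        2 * c⁻¹ * ((S ^ 2)⁻¹ * (L ^ 2 * d ^ 2 * Q ^ 2 * sqNorm z)) := by
        rw [hQ]
        gcongr
    _ = c * (S⁻¹ * Q + Q ^ 2) * sqNorm z + 2 * S⁻¹ ^ 2 * (c⁻¹ * c * c) * sqNorm z := by
        rw [ENNReal.inv_pow, hc]
        ring
    _ ≤ c * (S⁻¹ * Q + Q ^ 2) * sqNorm z + 2 * S⁻¹ ^ 2 * c * sqNorm z := by
        gcongr
        exact mul_le_of_le_one_left' (ENNReal.inv_mul_le_one c)
    _ = _ := by ring

end ExpectedEnergy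

section IndepFun

variable {Ω α β : Type*} [MeasurableSpace Ω] [MeasurableSpace α] [MeasurableSpace β]
  {μ : Measure Ω} [IsFiniteMeasure μ] {X : Ω → α} {Y : Ω → β}

theorem map_prodMk_eq_prod_of_indepFun (hX : Measurable X) (hY : Measurable Y)
    (h : IndepFun X Y μ) : μ.map (fun ω => (X ω, Y ω)) = (μ.map X).prod (μ.map Y) :=
  (indepFun_iff_map_prod_eq_prod_map_map hX.aemeasurable hY.aemeasurable).mp h

theorem lintegral_prodMk_of_indepFun (hX : Measurable X) (hY : Measurable Y)
    (h : IndepFun X Y μ) {F : α × β → ℝ≥0∞} (hF : Measurable F) :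
    ∫⁻ ω, F (X ω, Y ω) ∂μ = ∫⁻ ω, ∫⁻ y, F (X ω, y) ∂μ.map Y ∂μ := by
  rw [← lintegral_map hF (hX.prodMk hY), map_prodMk_eq_prod_of_indepFun hX hY h,
    lintegral_prod _ hF.aemeasurable, lintegral_map hF.lintegral_prod_right' hX]

theorem ae_prodMk_of_indepFun (hX : Measurable X) (hY : Measurable Y) (h : IndepFun X Y μ)
    {p : α × β → Prop} (hp : MeasurableSet {q | p q}) (hae : ∀ a, ∀ᵐ b ∂μ.map Y, p (a, b)) :
    ∀ᵐ ω ∂μ, p (X ω, Y ω) := by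
  rw [← ae_map_iff (hX.prodMk hY).aemeasurable hp, map_prodMk_eq_prod_of_indepFun hX hY h,
    Measure.ae_prod_iff_ae_ae hp]
  exact Filter.Eventually.of_forall hae

end IndepFun

namespace RandomNetwork

variable {L d : ℕ} {P : Measure ℝ} (N : RandomNetwork.{u} L d P)

theorem map_W : N.μ.map N.W = Measure.pi fun _ => P := by
  simpa only [N.law_W] using
    (iIndepFun_iff_map_fun_eq_pi_map fun a => (N.measurable_W a).aemeasurable).mp N.indep_W

theorem measurable_weights : Measurable N.W :=
  measurable_pi_lambda _ N.measurable_W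

/-- The squared Frobenius norm of the output matrix and the network input of the sample `i`: all
that the bound on the Hessian needs to know about the outer matrices. -/
noncomputable def outerData (i : Fin N.n) (ω : N.Ω) : ℝ≥0∞ × (Fin d → ℝ) :=
  (∑ o, sqNorm (N.B ω o), N.A ω *ᵥ N.x i)

/-- The pair of the input matrix and the output matrix. -/
def outerPair (ω : N.Ω) : (Fin d → Fin N.din → ℝ) × (Fin N.dout → Fin d → ℝ) :=
  (fun i j => N.A ω i j, fun i j => N.B ω i j)

theorem measurable_outerPair : Measurable N.outerPair :=
  (measurable_pi_lambda _ fun i => measurable_pi_lambda _ fun j => N.measurable_A i j).prodMk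
    (measurable_pi_lambda _ fun i => measurable_pi_lambda _ fun j => N.measurable_B i j)

theorem exists_measurable_comp_outerPair_eq (i : Fin N.n) :
    ∃ g : (Fin d → Fin N.din → ℝ) × (Fin N.dout → Fin d → ℝ) → ℝ≥0∞ × (Fin d → ℝ),
      Measurable g ∧ g ∘ N.outerPair = N.outerData i := by
  refine ⟨fun q => (∑ o, sqNorm (q.2 o), Matrix.of q.1 *ᵥ N.x i), Continuous.measurable ?_, rfl⟩
  have hB (o : Fin N.dout) :
      Continuous fun q : (Fin d → Fin N.din → ℝ) × (Fin N.dout → Fin d → ℝ) => q.2 o := by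
    fun_prop
  exact (continuous_finsetSum _ fun o _ => continuous_sqNorm.comp (hB o)).prodMk
    (Continuous.matrix_mulVec continuous_fst continuous_const)

theorem measurable_outerData (i : Fin N.n) : Measurable (N.outerData i) := by
  obtain ⟨g, hg, hgeq⟩ := N.exists_measurable_comp_outerPair_eq i
  exact hgeq ▸ hg.comp N.measurable_outerPair

theorem indepFun_outerData_W (i : Fin N.n) : IndepFun (N.outerData i) N.W N.μ := by
  obtain ⟨g, hg, hgeq⟩ := N.exists_measurable_comp_outerPair_eq i
  exact hgeq ▸ N.indep_AB_W.comp hg measurable_id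

variable {N} {act : Activation} {σ K : ℝ}

theorem BoundedBy.lintegral_outerData_le (hN : N.BoundedBy K) (i : Fin N.n) :
    ∫⁻ ω, (N.outerData i ω).1 * sqNorm (N.outerData i ω).2 ∂N.μ ≤ ENNReal.ofReal (K ^ 2) := by
  refine le_of_eq_of_le (lintegral_congr fun ω => ?_) (hN.outer i)
  rw [outerData, sum_sqNorm_eq_ofReal, sqNorm_eq_ofReal, ← ENNReal.ofReal_mul (by positivity)]

theorem measurable_mul_uncurry_sampleEnergy (act : Activation) (c : ℝ≥0∞) :
    Measurable fun q : (ℝ≥0∞ × (Fin d → ℝ)) × (WeightIndex L d → ℝ) =>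
      q.1.1 * Function.uncurry (sampleEnergy act c) (q.2, q.1.2) :=
  (measurable_fst.comp measurable_fst).mul ((measurable_sampleEnergy (L := L) (d := d) act c).comp
    (measurable_snd.prodMk (measurable_snd.comp measurable_fst)))

theorem BoundedBy.lintegral_mul_sampleEnergy_le (hN : N.BoundedBy K) (hP : IsWeightLaw act P σ)
    (i : Fin N.n) {Q : ℝ≥0∞} (hS : ENNReal.ofReal (act.p * d * σ ^ 2) ≠ 0)
    (hQ : Q ^ 2 = ENNReal.ofReal (act.p * d * σ ^ 2) ^ L) :
    ∫⁻ ω, (N.outerData i ω).1 *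
        sampleEnergy act (L * d * Q) (N.W ω) (N.outerData i ω).2 ∂N.μ ≤
      L * d * Q * ((ENNReal.ofReal (act.p * d * σ ^ 2))⁻¹ * Q + Q ^ 2 +
        2 * (ENNReal.ofReal (act.p * d * σ ^ 2))⁻¹ ^ 2) * ENNReal.ofReal (K ^ 2) := by
  set κ := L * d * Q * ((ENNReal.ofReal (act.p * d * σ ^ 2))⁻¹ * Q + Q ^ 2 +
    2 * (ENNReal.ofReal (act.p * d * σ ^ 2))⁻¹ ^ 2)
  have henergy : Measurable (Function.uncurry (sampleEnergy (L := L) (d := d) act (L * d * Q))) :=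
    measurable_sampleEnergy act _
  have houter : Measurable fun ω => (N.outerData i ω).1 * sqNorm (N.outerData i ω).2 :=
    (measurable_fst.comp (N.measurable_outerData i)).mul
      (continuous_sqNorm.measurable.comp (measurable_snd.comp (N.measurable_outerData i)))
  calc _ = ∫⁻ ω, ∫⁻ w, (N.outerData i ω).1 *
          sampleEnergy act (L * d * Q) w (N.outerData i ω).2 ∂N.μ.map N.W ∂N.μ :=
        lintegral_prodMk_of_indepFun (N.measurable_outerData i) N.measurable_weights
          (N.indepFun_outerData_W i) (measurable_mul_uncurry_sampleEnergy act _)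
    _ ≤ ∫⁻ ω, κ * ((N.outerData i ω).1 * sqNorm (N.outerData i ω).2) ∂N.μ := by
        refine lintegral_mono fun ω => ?_
        rw [N.map_W, lintegral_const_mul _ henergy.of_uncurry_right, mul_left_comm]
        gcongr
        exact lintegral_sampleEnergy_le hP _ hS hQ
    _ ≤ κ * ENNReal.ofReal (K ^ 2) := by
        rw [lintegral_const_mul _ houter]
        gcongr
        exact hN.lintegral_outerData_le i

theorem BoundedBy.expectedMaxEigenvalue_le_mul (hN : N.BoundedBy K) {c κ : ℝ≥0∞} (h0 : c ≠ 0)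
    (htop : c ≠ ⊤) (hκ : ∀ i, ∫⁻ ω, (N.outerData i ω).1 *
      sampleEnergy act c (N.W ω) (N.outerData i ω).2 ∂N.μ ≤ κ * ENNReal.ofReal (K ^ 2)) :
    N.expectedMaxEigenvalue act ≤ (c + κ) * ENNReal.ofReal (K ^ 2) := by
  have hmeas (i : Fin N.n) : Measurable fun ω =>
      (N.outerData i ω).1 * sampleEnergy act c (N.W ω) (N.outerData i ω).2 :=
    (measurable_mul_uncurry_sampleEnergy act c).comp
      ((N.measurable_outerData i).prodMk N.measurable_weights)
  have htarget (i : Fin N.n) : sqNorm (N.y i) ≤ ENNReal.ofReal (K ^ 2) := by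
    rw [sqNorm_eq_ofReal]
    exact ENNReal.ofReal_le_ofReal (hN.target i)
  calc N.expectedMaxEigenvalue act
      ≤ ∫⁻ ω, (N.n : ℝ≥0∞)⁻¹ * ∑ i, (c * sqNorm (N.y i) + (N.outerData i ω).1 *
          sampleEnergy act c (N.W ω) (N.outerData i ω).2) ∂N.μ :=
        lintegral_mono fun ω => spectralRadius_networkHessian_le act _ _ _ _ _ h0 htop
    _ = (N.n : ℝ≥0∞)⁻¹ * ∑ i, (c * sqNorm (N.y i) + ∫⁻ ω, (N.outerData i ω).1 *
          sampleEnergy act c (N.W ω) (N.outerData i ω).2 ∂N.μ) := by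
        rw [lintegral_const_mul _ (Finset.measurable_sum _ fun i _ => (hmeas i).const_add _),
          lintegral_finsetSum _ fun i _ => (hmeas i).const_add _]
        simp only [lintegral_add_left measurable_const, lintegral_const, measure_univ, mul_one]
    _ ≤ (N.n : ℝ≥0∞)⁻¹ * ∑ _i : Fin N.n, (c + κ) * ENNReal.ofReal (K ^ 2) := by
        gcongr with i
        rw [add_mul]
        gcongr
        · exact htarget i
        · exact hκ i
    _ ≤ (c + κ) * ENNReal.ofReal (K ^ 2) := by
        rw [Finset.sum_const, Finset.card_univ, Fintype.card_fin, nsmul_eq_mul, ← mul_assoc]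
        exact mul_le_of_le_one_left' (ENNReal.inv_mul_le_one _)

theorem expectedMaxEigenvalue_of_isEmpty [IsEmpty (WeightIndex L d)] :
    N.expectedMaxEigenvalue act = 0 := by
  simp [expectedMaxEigenvalue]

theorem BoundedBy.expectedMaxEigenvalue_le (hN : N.BoundedBy K) (hP : IsWeightLaw act P σ)
    {s₀ M : ℝ} (hs₀ : 0 < s₀) (h₀ : s₀ ≤ act.p * d * σ ^ 2)
    (hM : (act.p * d * σ ^ 2) ^ ((L : ℝ) / 2) ≤ M) :
    N.expectedMaxEigenvalue act ≤ ENNReal.ofReal (L * d *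
      ((1 + M / s₀ + M ^ 2 + 2 / s₀ ^ 2) * K ^ 2 *
        (act.p * d * σ ^ 2) ^ ((L : ℝ) / 2))) := by
  rcases isEmpty_or_nonempty (WeightIndex L d) with _ | ⟨l, i, _⟩
  · simp [expectedMaxEigenvalue_of_isEmpty]
  have hL : (0 : ℝ) < L := by exact_mod_cast l.pos
  have hd : (0 : ℝ) < d := by exact_mod_cast i.pos
  set s := act.p * d * σ ^ 2
  have hs0 : 0 < s := hs₀.trans_le h₀
  set q := s ^ ((L : ℝ) / 2) with hq
  have hq0 : 0 < q := Real.rpow_pos_of_pos hs0 _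
  have hqq : q ^ 2 = s ^ L := by
    rw [hq, ← Real.rpow_mul_natCast hs0.le, Nat.cast_ofNat, div_mul_cancel₀ _ two_ne_zero,
      Real.rpow_natCast]
  have hc : ENNReal.ofReal (L * d * q) = L * d * ENNReal.ofReal q := by
    simp (disch := positivity) only [ENNReal.ofReal_mul, ENNReal.ofReal_natCast]
  have hκ : ENNReal.ofReal (L * d * q * (s⁻¹ * q + q ^ 2 + 2 * s⁻¹ ^ 2)) =
      L * d * ENNReal.ofReal q * ((ENNReal.ofReal s)⁻¹ * ENNReal.ofReal q +
        ENNReal.ofReal q ^ 2 + 2 * (ENNReal.ofReal s)⁻¹ ^ 2) := by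
    simp (disch := positivity) only [ENNReal.ofReal_mul, ENNReal.ofReal_add, ENNReal.ofReal_pow,
      ENNReal.ofReal_inv_of_pos, ENNReal.ofReal_natCast, ENNReal.ofReal_ofNat]
  have hbound := hN.expectedMaxEigenvalue_le_mul (c := L * d * ENNReal.ofReal q)
    (hc ▸ by positivity) (hc ▸ ENNReal.ofReal_ne_top) fun i =>
    hN.lintegral_mul_sampleEnergy_le hP i (Q := ENNReal.ofReal q) (by positivity) (by
      rw [← ENNReal.ofReal_pow hq0.le, ← ENNReal.ofReal_pow hs0.le, hqq])
  rw [← hκ, ← hc, ← ENNReal.ofReal_add (by positivity) (by positivity),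
    ← ENNReal.ofReal_mul (by positivity)] at hbound
  refine hbound.trans (ENNReal.ofReal_le_ofReal ?_)
  calc (L * d * q + L * d * q * (s⁻¹ * q + q ^ 2 + 2 * s⁻¹ ^ 2)) * K ^ 2
      ≤ (L * d * q + L * d * q * (s₀⁻¹ * M + M ^ 2 + 2 * s₀⁻¹ ^ 2)) * K ^ 2 := by gcongr
    _ = _ := by ring

end RandomNetwork

namespace Activation

theorem eventually_gate_eq (act : Activation) {t : ℝ} (ht : t ≠ 0) :
    ∀ᶠ s in 𝓝 t, act.gate s = act.gate t := by
  cases act with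
  | linear => exact .of_forall fun _ => rfl
  | relu =>
    rcases lt_or_gt_of_ne ht with h | h
    · filter_upwards [eventually_lt_nhds h] with s hs
      simp only [gate, hs.not_gt, h.not_gt, if_false]
    · filter_upwards [eventually_gt_nhds h] with s hs
      simp only [gate, hs, h, if_true]

theorem eventually_fn_eq_zero (act : Activation) {t : ℝ} (ht : t ≠ 0) (h : act.fn t = 0) :
    ∀ᶠ s in 𝓝 t, act.fn s = 0 := by
  have hgate : act.gate t = 0 := by
    rw [← act.gate_mul_self] at h
    exact (mul_eq_zero.mp h).resolve_right ht
  filter_upwards [act.eventually_gate_eq ht] with s hs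
  rw [← act.gate_mul_self, hs, hgate, zero_mul]

end Activation

section LocallyConstantGates

variable {L d : ℕ} {act : Activation}

theorem preact_eq_gatedForward (act : Activation) (w : WeightIndex L d → ℝ) (z : Fin d → ℝ)
    (k : ℕ) : preact act w z k = gatedForward (gates act w z) w z k := by
  induction k with
  | zero => rfl
  | succ k ih => simp only [preact, gatedForward, ← ih, gates, act.gate_mul_self]

/-- Every preactivation is nonzero, unless all inputs of the neuron vanish. A dead layer makes all
later preactivations vanish, whatever the weights, so more cannot be asked for. -/
def IsNondegenerate (act : Activation) (w : WeightIndex L d → ℝ) (z : Fin d → ℝ) : Prop :=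
  ∀ k < L, ∀ j j', act.fn (preact act w z k j') = 0 ∨ preact act w z (k + 1) j ≠ 0

theorem IsNondegenerate.preact_ne_zero_or_eventually_eq_zero {w₀ : WeightIndex L d → ℝ}
    {z : Fin d → ℝ} (h : IsNondegenerate act w₀ z) {k : ℕ} (hk : k ≤ L) (j : Fin d) :
    preact act w₀ z k j ≠ 0 ∨ ∀ᶠ w in 𝓝 w₀, preact act w z k j = 0 := by
  induction k generalizing j with
  | zero => exact (ne_or_eq (z j) 0).imp_right fun hz => .of_forall fun _ => hz
  | succ k ih =>
    refine or_iff_not_imp_left.mpr fun hzero => ?_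
    have hinputs (j' : Fin d) : ∀ᶠ w in 𝓝 w₀, act.fn (preact act w z k j') = 0 := by
      have hfn := (h k hk j j').resolve_right hzero
      have hcont : Continuous fun w : WeightIndex L d → ℝ => preact act w z k j' :=
        (continuous_apply j').comp ((continuous_preact act k).comp (.prodMk_left z))
      rcases ih (Nat.le_of_succ_le hk) j' with hne | hev
      · exact hcont.continuousAt.eventually (act.eventually_fn_eq_zero hne hfn)
      · filter_upwards [hev] with w hw
        simpa only [hw, hev.self_of_nhds] using hfn
    filter_upwards [Filter.eventually_all.mpr hinputs] with w hw
    simp [preact, hw, Matrix.mulVec, dotProduct]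

theorem IsNondegenerate.eventually_gates_eq {w₀ : WeightIndex L d → ℝ} {z : Fin d → ℝ}
    (h : IsNondegenerate act w₀ z) :
    ∀ᶠ w in 𝓝 w₀, ∀ k ≤ L, gates act w z k = gates act w₀ z k := by
  have hneuron (k : ℕ) (hk : k ≤ L) (j : Fin d) :
      ∀ᶠ w in 𝓝 w₀, gates act w z k j = gates act w₀ z k j := by
    have hcont : Continuous fun w : WeightIndex L d → ℝ => preact act w z k j :=
      (continuous_apply j).comp ((continuous_preact act k).comp (.prodMk_left z))
    rcases h.preact_ne_zero_or_eventually_eq_zero hk j with hne | hev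
    · exact hcont.continuousAt.eventually (act.eventually_gate_eq hne)
    · filter_upwards [hev] with w hw
      simp only [gates, hw, hev.self_of_nhds]
  refine (Filter.eventually_all_finite (Set.finite_Iic L)).mpr fun k hk => ?_
  filter_upwards [Filter.eventually_all.mpr (hneuron k hk)] with w hw using funext hw

end LocallyConstantGates

section Loss

variable {L d din dout n : ℕ} (act : Activation) (A : Matrix (Fin d) (Fin din) ℝ)
  (B : Matrix (Fin dout) (Fin d) ℝ) (x : Fin n → Fin din → ℝ) (y : Fin n → Fin dout → ℝ)
  {w₀ w : WeightIndex L d → ℝ}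

theorem mlpLoss_eq_gatedLoss
    (h : ∀ i, ∀ k ≤ L, gates act w (A *ᵥ x i) k = gates act w₀ (A *ᵥ x i) k) :
    mlpLoss act A B x y w = gatedLoss act A B x y w₀ w := by
  have houtput (i : Fin n) : (fun j => act.fn (preact act w (A *ᵥ x i) L j)) =
      gatedState act w₀ (A *ᵥ x i) w L := by
    ext j
    rw [gatedState, ← h i L le_rfl,
      ← gatedForward_congr (A *ᵥ x i) (fun k hk => h i k hk.le) fun _ _ => rfl,
      ← preact_eq_gatedForward, gates, act.gate_mul_self]
  simp only [mlpLoss, houtput]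
  rfl

theorem contDiff_gatedLoss (w₀ : WeightIndex L d → ℝ) {r : WithTop ℕ∞} :
    ContDiff ℝ r (gatedLoss act A B x y w₀) :=
  contDiff_const.mul (ContDiff.sum fun i _ => ContDiff.sum fun o _ =>
    (contDiff_const.sub (contDiff_gatedOutput B (gates act w₀ (A *ᵥ x i)) (A *ᵥ x i) o)).pow 2)

theorem contDiffAt_mlpLoss_and_hessianMatrix_eq
    (h : ∀ i, ∀ᶠ w in 𝓝 w₀, ∀ k ≤ L, gates act w (A *ᵥ x i) k = gates act w₀ (A *ᵥ x i) k) :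
    ContDiffAt ℝ 2 (mlpLoss act A B x y) w₀ ∧
      hessianMatrix (mlpLoss act A B x y) w₀ = networkHessian act A B x y w₀ := by
  have heq : mlpLoss act A B x y =ᶠ[𝓝 w₀] gatedLoss act A B x y w₀ := by
    filter_upwards [Filter.eventually_all.mpr h] with w hw
    exact mlpLoss_eq_gatedLoss act A B x y hw
  refine ⟨(contDiff_gatedLoss act A B x y w₀).contDiffAt.congr_of_eventuallyEq heq, ?_⟩
  ext a b
  simp only [networkHessian, hessianMatrix, Matrix.of_apply, (heq.iteratedFDeriv ℝ 2).eq_of_nhds]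

end Loss

section AlmostEverywhere

theorem ae_pi_of_forall_ae_update {ι : Type*} [Fintype ι] [DecidableEq ι] {X : ι → Type*}
    [∀ i, MeasurableSpace (X i)] {μ : ∀ i, Measure (X i)} [∀ i, SigmaFinite (μ i)] (a : ι)
    {p : (∀ i, X i) → Prop} (hp : MeasurableSet {w | p w})
    (h : ∀ w, ∀ᵐ t ∂μ a, p (Function.update w a t)) : ∀ᵐ w ∂Measure.pi μ, p w := by
  have hmeas : Measurable ({w | p w}ᶜ.indicator (1 : (∀ i, X i) → ℝ≥0∞)) :=
    measurable_one.indicator hp.compl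
  rw [ae_iff, ← Set.compl_ofPred, ← lintegral_indicator_one hp.compl, ← nonpos_iff_eq_zero]
  refine (lintegral_le_of_lmarginal_le (g := 0) {a} hmeas measurable_zero fun w => ?_).trans
    (by simp)
  rw [lmarginal_singleton]
  refine (lintegral_eq_zero_of_ae_eq_zero ?_).trans_le zero_le
  filter_upwards [h w] with t ht
  exact Set.indicator_of_notMem (not_not.mpr ht) _

theorem ae_eq_zero_or_mul_add_ne_zero {P : Measure ℝ} [NullSingletonClass P] (c r : ℝ) :
    ∀ᵐ t ∂P, c = 0 ∨ t * c + r ≠ 0 := by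
  rcases eq_or_ne c 0 with hc | hc
  · exact .of_forall fun _ => .inl hc
  · filter_upwards [compl_mem_ae_iff.mpr (measure_singleton (-r / c))] with t ht
    refine .inr fun hroot => ht ?_
    rw [Set.mem_singleton_iff, eq_div_iff hc]
    exact eq_neg_of_add_eq_zero_left hroot

end AlmostEverywhere

section Nondegenerate

variable {L d : ℕ} {P : Measure ℝ}

theorem update_eq_add_smul_single {ι R : Type*} [DecidableEq ι] [Ring R] (w : ι → R) (a : ι)
    (t : R) : Function.update w a t = w + (t - w a) • Pi.single a 1 := by
  ext b
  rcases eq_or_ne b a with rfl | h <;> simp [*]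

theorem preact_succ_add_smul_single (act : Activation) (z : Fin d → ℝ) (w : WeightIndex L d → ℝ)
    (l : Fin L) (j j' : Fin d) (t : ℝ) :
    preact act (w + t • Pi.single (l, j, j') 1) z (l + 1) j =
      preact act w z (l + 1) j + t * act.fn (preact act w z l j') := by
  have hpre : preact act (w + t • Pi.single (l, j, j') 1) z l = preact act w z l :=
    preact_add_smul_single_of_le act w z le_rfl t
  have hweight := weightMatrix_add_smul_single_self (l, j, j') w t
  simp only [preact, hpre, hweight, Matrix.add_mulVec, Matrix.smul_mulVec, Matrix.single_mulVec]
  simp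

theorem measurableSet_fn_preact_eq_zero_or_preact_succ_ne_zero (act : Activation) (k : ℕ)
    (j j' : Fin d) : MeasurableSet {q : (WeightIndex L d → ℝ) × (Fin d → ℝ) |
      act.fn (preact act q.1 q.2 k j') = 0 ∨ preact act q.1 q.2 (k + 1) j ≠ 0} := by
  have hpre (k : ℕ) (j : Fin d) : Continuous fun q : (WeightIndex L d → ℝ) × (Fin d → ℝ) =>
      preact act q.1 q.2 k j := (continuous_apply j).comp (continuous_preact act k)
  exact (measurableSet_eq_fun (act.continuous_fn.comp (hpre k j')).measurable
    measurable_const).union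
    (measurableSet_eq_fun (hpre (k + 1) j).measurable measurable_const).compl

theorem ae_fn_preact_eq_zero_or_preact_succ_ne_zero [SigmaFinite P] [NullSingletonClass P]
    (act : Activation) (z : Fin d → ℝ) (l : Fin L) (j j' : Fin d) :
    ∀ᵐ w : WeightIndex L d → ℝ ∂Measure.pi (fun _ => P),
      act.fn (preact act w z l j') = 0 ∨ preact act w z (l + 1) j ≠ 0 := by
  refine ae_pi_of_forall_ae_update (l, j, j')
    (measurable_prodMk_right (measurableSet_fn_preact_eq_zero_or_preact_succ_ne_zero act l j j'))
    fun w => ?_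
  set c := act.fn (preact act w z l j')
  filter_upwards [ae_eq_zero_or_mul_add_ne_zero c
    (preact act w z (l + 1) j - w (l, j, j') * c)] with t ht
  have hpre : preact act (w + (t - w (l, j, j')) • Pi.single (l, j, j') 1) z l =
      preact act w z l := preact_add_smul_single_of_le act w z le_rfl _
  rw [update_eq_add_smul_single, preact_succ_add_smul_single, hpre]
  convert ht using 2
  ring

theorem RandomNetwork.ae_isNondegenerate [NullSingletonClass P] (N : RandomNetwork.{u} L d P)
    (act : Activation) (i : Fin N.n) :
    ∀ᵐ ω ∂N.μ, IsNondegenerate act (N.W ω) (N.A ω *ᵥ N.x i) := by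
  have hneuron (l : Fin L) (j j' : Fin d) : ∀ᵐ ω ∂N.μ,
      act.fn (preact act (N.W ω) (N.A ω *ᵥ N.x i) l j') = 0 ∨
        preact act (N.W ω) (N.A ω *ᵥ N.x i) (l + 1) j ≠ 0 := by
    have : IsProbabilityMeasure P := N.law_W (l, j, j') ▸
      Measure.isProbabilityMeasure_map (N.measurable_W (l, j, j')).aemeasurable
    refine ae_prodMk_of_indepFun (N.measurable_outerData i) N.measurable_weights
      (N.indepFun_outerData_W i) (p := fun q => act.fn (preact act q.2 q.1.2 l j') = 0 ∨
        preact act q.2 q.1.2 (l + 1) j ≠ 0)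
      ((measurable_snd.prodMk (measurable_snd.comp measurable_fst))
        (measurableSet_fn_preact_eq_zero_or_preact_succ_ne_zero act l j j')) fun q => ?_
    rw [N.map_W]
    exact ae_fn_preact_eq_zero_or_preact_succ_ne_zero act q.2 l j j'
  filter_upwards [ae_all_iff.mpr fun l => ae_all_iff.mpr fun j => ae_all_iff.mpr (hneuron l j)]
    with ω hω k hk j j' using hω ⟨k, hk⟩ j j'

theorem RandomNetwork.ae_contDiffAt_loss_and_hessianMatrix_eq (N : RandomNetwork.{u} L d P)
    (act : Activation) (h : act = .linear ∨ NullSingletonClass P) :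
    ∀ᵐ ω ∂N.μ, ContDiffAt ℝ 2 (N.loss act ω) (N.W ω) ∧
      hessianMatrix (N.loss act ω) (N.W ω) = N.hessian act ω := by
  have hgates : ∀ᵐ ω ∂N.μ, ∀ i, ∀ᶠ w in 𝓝 (N.W ω), ∀ k ≤ L,
      gates act w (N.A ω *ᵥ N.x i) k = gates act (N.W ω) (N.A ω *ᵥ N.x i) k := by
    rcases h with rfl | h
    · exact .of_forall fun _ _ => .of_forall fun _ _ _ => rfl
    · filter_upwards [ae_all_iff.mpr (N.ae_isNondegenerate act)] with ω hω i
      exact (hω i).eventually_gates_eq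
  filter_upwards [hgates] with ω hω
  exact contDiffAt_mlpLoss_and_hessianMatrix_eq act (N.A ω) (N.B ω) N.x N.y hω

end Nondegenerate

theorem corollary1_general (act : Activation) :
    (∀ K s₀ : ℝ, 0 < s₀ → ∃ C : ℝ, 0 ≤ C ∧
      ∀ (L d : ℕ) (P : Measure ℝ) (σ : ℝ) (N : RandomNetwork.{u} L d P),
        IsWeightLaw act P σ → N.BoundedBy K →
        s₀ ≤ act.p * d * σ ^ 2 → act.p * d * σ ^ 2 ≤ 1 →
        N.expectedMaxEigenvalue act ≤
          ENNReal.ofReal (L * d * (C * (act.p * d * σ ^ 2) ^ ((L : ℝ) / 2)))) ∧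
    (∀ K s₀ s₁ : ℝ, 0 < s₀ → ∀ L : ℕ, ∃ C : ℝ, 0 ≤ C ∧
      ∀ (d : ℕ) (P : Measure ℝ) (σ : ℝ) (N : RandomNetwork.{u} L d P),
        IsWeightLaw act P σ → N.BoundedBy K →
        s₀ ≤ act.p * d * σ ^ 2 → act.p * d * σ ^ 2 ≤ s₁ →
        N.expectedMaxEigenvalue act ≤
          ENNReal.ofReal (L * d * (C * (act.p * d * σ ^ 2) ^ ((L : ℝ) / 2)))) ∧
    (∀ (L d : ℕ) (P : Measure ℝ) (N : RandomNetwork.{u} L d P),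
      (act = Activation.linear ∨ NullSingletonClass P) →
      ∀ᵐ ω ∂N.μ, ContDiffAt ℝ 2 (N.loss act ω) (N.W ω) ∧
        hessianMatrix (N.loss act ω) (N.W ω) = N.hessian act ω) := by
  refine ⟨fun K s₀ hs₀ => ?_, fun K s₀ s₁ hs₀ L => ?_,
    fun L d P N h => N.ae_contDiffAt_loss_and_hessianMatrix_eq act h⟩
  · refine ⟨(1 + 1 / s₀ + 1 ^ 2 + 2 / s₀ ^ 2) * K ^ 2, by positivity,
      fun L d P σ N hP hN h₀ h₁ => hN.expectedMaxEigenvalue_le hP hs₀ h₀ ?_⟩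
    exact Real.rpow_le_one (hs₀.le.trans h₀) h₁ (by positivity)
  · let M := |s₁| ^ ((L : ℝ) / 2)
    refine ⟨(1 + M / s₀ + M ^ 2 + 2 / s₀ ^ 2) * K ^ 2, by positivity,
      fun d P σ N hP hN h₀ h₁ => hN.expectedMaxEigenvalue_le hP hs₀ h₀ ?_⟩
    exact Real.rpow_le_rpow (hs₀.le.trans h₀) (h₁.trans (le_abs_self s₁)) (by positivity)

theorem corollary1 (act : Activation) :
    -- depth-uniform bound in the vanishing or stable regime `p d σ² ≤ 1`
    (∀ K s₀ : ℝ, 0 < s₀ → ∃ C : ℝ, 0 ≤ C ∧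
      ∀ (L d : ℕ) (P : Measure ℝ) (σ : ℝ) (N : RandomNetwork.{u} L d P),
        IsInitLaw P σ → N.BoundedBy K →
        s₀ ≤ act.p * d * σ ^ 2 → act.p * d * σ ^ 2 ≤ 1 →
        N.expectedMaxEigenvalue act ≤
          ENNReal.ofReal (L * d * (C * (act.p * d * σ ^ 2) ^ ((L : ℝ) / 2)))) ∧
    -- width-uniform bound at each fixed depth, for `p d σ²` in any bounded range
    (∀ K s₀ s₁ : ℝ, 0 < s₀ → ∀ L : ℕ, ∃ C : ℝ, 0 ≤ C ∧
      ∀ (d : ℕ) (P : Measure ℝ) (σ : ℝ) (N : RandomNetwork.{u} L d P),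
        IsInitLaw P σ → N.BoundedBy K →
        s₀ ≤ act.p * d * σ ^ 2 → act.p * d * σ ^ 2 ≤ s₁ →
        N.expectedMaxEigenvalue act ≤
          ENNReal.ofReal (L * d * (C * (act.p * d * σ ^ 2) ^ ((L : ℝ) / 2)))) ∧
    -- for linear networks, and for ReLU networks with an atomless weight law, the loss is almost
    -- surely twice differentiable at the initialization, with the Hessian used above
    (∀ (L d : ℕ) (P : Measure ℝ) (σ : ℝ) (N : RandomNetwork.{u} L d P), IsInitLaw P σ →
      (act = Activation.linear ∨ ∀ t : ℝ, P {t} = 0) →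
      ∀ᵐ ω ∂N.μ, ContDiffAt ℝ 2 (N.loss act ω) (N.W ω) ∧
        hessianMatrix (N.loss act ω) (N.W ω) = N.hessian act ω) := by
  obtain ⟨hstable, hbounded, hsmooth⟩ := corollary1_general.{u} act
  refine ⟨fun K s₀ hs₀ => (hstable K s₀ hs₀).imp fun C => ?_,
    fun K s₀ s₁ hs₀ L => (hbounded K s₀ s₁ hs₀ L).imp fun C => ?_,
    fun L d P _ N _ h => hsmooth L d P N (h.imp_right .mk)⟩
  · exact And.imp_right fun h L d P σ N hP => h L d P σ N (hP.isWeightLaw act)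
  · exact And.imp_right fun h d P σ N hP => h d P σ N (hP.isWeightLaw act)
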